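/- Let $q\ge 0$ and $s\ge q+2$ be integers, and let $(X_r,W_r)$, $r=1,\dots,s$, be i.i.d. $(1+q)$-variate normal vectors: $X_r\in\mathbb R$ is the $r$-th observed reward of a fixed arm and $W_r=(W_{r,1},\dots,W_{r,q})^\top\in\mathbb R^q$ is the vector of its control variates. Let $\omega=\mathbb E[W_r]$ (known), and assume that the covariance matrix of $W_r$ is positive definite. Write $$\hat\mu=\frac1s\sum_{r=1}^sX_r,\qquad \hat\omega=\frac1s\sum_{r=1}^sW_r,\qquad S_{WW}=\frac1{s-1}\Big(\sum_{r=1}^sW_rW_r^\top-s\,\hat\omega\hat\omega^\top\Big),\qquad S_{XW}=\frac1{s-1}\Big(\sum_{r=1}^sX_rW_r-s\,\hat\mu\,\hat\omega\Big),$$ $$\hat\beta=S_{WW}^{-1}S_{XW},\qquad \hat\mu^c=\hat\mu+\hat\beta^\top(\omega-\hat\omega),\qquad \bar X_r=X_r+\hat\beta^\top(\omega-W_r),$$ $$\hat\sigma_c^2=\frac1{s-q-1}\sum_{r=1}^s(\bar X_r-\hat\mu^c)^2,\qquad Z=1+\frac{(\hat\omega-\omega)^\top S_{WW}^{-1}(\hat\omega-\omega)}{1-1/s},\qquad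 \hat\nu=\frac{Z\,\hat\sigma_c^2}{s}.$$ Then $\hat\nu$ is an unbiased estimator of the variance of the mean reward estimator $\hat\mu^c$: $$\mathbb E[\hat\nu]=\operatorname{Var}(\hat\mu^c),$$ where for $s\ge q+2$ the equality holds in $[0,\infty]$; moreover, if $s\ge q+3$, then $\hat\mu^c$ is square integrable and $\hat\nu$ is integrable, so that both sides are finite. -/

import Mathlib

open MeasureTheory ProbabilityTheory
open scoped Matrix ENNReal

noncomputable section

namespace ControlVariates

variable {s q : ℕ}

/-- The sample mean of the `s` rewards `x`. -/
def rewardMean (x : Fin s → ℝ) : ℝ := (∑ r, x r) / s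

/-- The vector of sample means of the `q` control variates; row `r` of `w` holds the control
variates of the `r`-th sample. -/
def cvMean (w : Matrix (Fin s) (Fin q) ℝ) : Fin q → ℝ := fun j => (∑ r, w r j) / s

/-- Sample covariance matrix of the control variates,
`(s - 1)⁻¹ (wᵀ w - s ŵ ŵᵀ)` with `ŵ` the vector of sample means. -/
def SWW (w : Matrix (Fin s) (Fin q) ℝ) : Matrix (Fin q) (Fin q) ℝ :=
  ((s : ℝ) - 1)⁻¹ • (wᵀ * w - (s : ℝ) • Matrix.vecMulVec (cvMean w) (cvMean w))

/-- Sample covariance vector of the rewards and the control variates,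
`(s - 1)⁻¹ (wᵀ x - s ŵ x̂)`. -/
def SXW (x : Fin s → ℝ) (w : Matrix (Fin s) (Fin q) ℝ) : Fin q → ℝ :=
  ((s : ℝ) - 1)⁻¹ • (wᵀ *ᵥ x - ((s : ℝ) * rewardMean x) • cvMean w)

/-- The estimated coefficient vector. -/
def betaHat (x : Fin s → ℝ) (w : Matrix (Fin s) (Fin q) ℝ) : Fin q → ℝ :=
  (SWW w)⁻¹ *ᵥ SXW x w

/-- The control variate estimator of the mean reward; `m` is the known mean of the control
variates. -/
def muHatC (m : Fin q → ℝ) (x : Fin s → ℝ) (w : Matrix (Fin s) (Fin q) ℝ) : ℝ :=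
  rewardMean x + betaHat x w ⬝ᵥ (m - cvMean w)

/-- The `r`-th reward corrected by its control variates, with the estimated coefficients.
The mean of these over `r` is `muHatC`. -/
def xBar (m : Fin q → ℝ) (x : Fin s → ℝ) (w : Matrix (Fin s) (Fin q) ℝ) (r : Fin s) : ℝ :=
  x r + betaHat x w ⬝ᵥ (m - w r)

/-- The residual variance, with divisor `s - q - 1`. -/
def sigmaHatSq (m : Fin q → ℝ) (x : Fin s → ℝ) (w : Matrix (Fin s) (Fin q) ℝ) : ℝ :=
  (∑ r, (xBar m x w r - muHatC m x w) ^ 2) / ((s : ℝ) - q - 1)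

/-- The factor `1 + (ŵ - m)ᵀ S_WW⁻¹ (ŵ - m) / (1 - 1/s)`. -/
def zFactor (m : Fin q → ℝ) (w : Matrix (Fin s) (Fin q) ℝ) : ℝ :=
  1 + ((cvMean w - m) ⬝ᵥ ((SWW w)⁻¹ *ᵥ (cvMean w - m))) / (1 - 1 / (s : ℝ))

/-- The sample variance of the mean reward estimator. -/
def nuHat (m : Fin q → ℝ) (x : Fin s → ℝ) (w : Matrix (Fin s) (Fin q) ℝ) : ℝ :=
  zFactor m w * sigmaHatSq m x w / s

end ControlVariates

end

/-! Whitening the control variates and regressing the reward on them gives W_r = m + Bᵀg_r and X_r =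
μ + γ·g_r + e_r, with g_r standard normal and e_r centred and uncorrelated with g_r. Joint normality
makes the noise e independent of the whole array G. For fixed G everything is least squares: the
estimator is μ + a(G)·e for a weight vector a(G), the residual vector is Q(G)e with Q(G) an
orthogonal projection of rank s − q − 1, and Z/s = |a(G)|². Integrating over the noise first, the
squared error of the estimator and ν̂ both average to v|a(G)|², v being the noise variance. Hence
the equality in [0, ∞] (`muHatC_model`, `nuHat_model`, `unbiased_of_noise`).

This needs the scatter matrix T of G to be almost surely invertible and, for s ≥ q + 3, a finite
expectation of ĝᵀT⁻¹ĝ, where ĝ is the vector of column means of G. Both follow, without Wishart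
densities, from one Stein identity (`integral_stein_scatter`). Let R = (T + δ)⁻¹, let V be the
centred G and let u be affine in ĝ. Integration by parts for the field V R u uᵀ gives E[(s − q − 2)
uᵀRu + δ·(nonnegative)] = E|u|². Constant u bounds the Frobenius norm of R, which is at least 1/δ
wherever T is singular, so that event is null (`ae_isUnit_det_scatter`). For u = ĝ and s ≥ q + 3 the
bound on E[uᵀRu] is uniform in δ, and Fatou as δ → 0 concludes (`lintegral_hotelling_lt_top`). -/

namespace ControlVariates

/-! ### Stein's identity for independent standard normal variables. -/

/-- Gaussian integration by parts on the real line. -/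
lemma integral_id_mul_gaussianReal {f f' : ℝ → ℝ} (hd : ∀ t, HasDerivAt f (f' t) t)
    (hf : Integrable f (gaussianReal 0 1)) (hf' : Integrable f' (gaussianReal 0 1))
    (hxf : Integrable (fun t => t * f t) (gaussianReal 0 1)) :
    ∫ t, t * f t ∂gaussianReal 0 1 = ∫ t, f' t ∂gaussianReal 0 1 := by
  have hφ : ∀ t, HasDerivAt (gaussianPDFReal 0 1) (-t * gaussianPDFReal 0 1 t) t := by
    intro t
    have h1 : HasDerivAt (fun x : ℝ => -(x - 0) ^ 2 / (2 * ((1 : NNReal) : ℝ))) (-t) t := by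
      have h2 := (((hasDerivAt_id t).sub_const 0).pow 2).neg.div_const (2 * ((1 : NNReal) : ℝ))
      simp only [NNReal.coe_one, mul_one] at h2 ⊢
      refine h2.congr_deriv ?_
      simp only [id_eq, sub_zero]
      norm_num
      ring
    have h3 := (h1.exp).const_mul (Real.sqrt (2 * Real.pi * ((1 : NNReal) : ℝ)))⁻¹
    rw [gaussianPDFReal_def]
    exact h3.congr_deriv (by ring)
  have hint : ∀ g : ℝ → ℝ, Integrable g (gaussianReal 0 1) →
      Integrable (fun t => g t * gaussianPDFReal 0 1 t) := by
    intro g hg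
    rw [gaussianReal_of_var_ne_zero 0 one_ne_zero, integrable_withDensity_iff
      (measurable_gaussianPDF 0 1) (Filter.Eventually.of_forall fun _ => gaussianPDF_lt_top)] at hg
    simpa only [toReal_gaussianPDF] using hg
  -- The density satisfies φ' = −tφ. Integrability of fφ together with both products replaces decay
  -- conditions at infinity.
  have hparts := integral_mul_deriv_eq_deriv_mul_of_integrable (u := f) (u' := f')
    (v := gaussianPDFReal 0 1) (v' := fun t => -t * gaussianPDFReal 0 1 t)
    (fun t _ => hd t) (fun t _ => hφ t)
    ((hint _ hxf).neg.congr (Filter.Eventually.of_forall fun t => by simp; ring))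
    (hint _ hf') (hint _ hf)
  rw [integral_gaussianReal_eq_integral_smul one_ne_zero,
    integral_gaussianReal_eq_integral_smul one_ne_zero]
  simp only [smul_eq_mul]
  have h4 : ∫ t, gaussianPDFReal 0 1 t * (t * f t)
      = - ∫ t, f t * (-t * gaussianPDFReal 0 1 t) := by
    rw [← integral_neg]
    exact integral_congr_ae (Filter.Eventually.of_forall fun t => by simp; ring)
  rw [h4, hparts, neg_neg]
  exact integral_congr_ae (Filter.Eventually.of_forall fun t => by simp; ring)

section Pi

variable {ι : Type*} [Fintype ι] [DecidableEq ι]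

/-- The law of `Fintype.card ι` independent standard normal variables. -/
noncomputable abbrev stdPi (ι : Type*) [Fintype ι] : Measure (ι → ℝ) :=
  Measure.pi fun _ : ι => gaussianReal 0 1

/-- Resampling one coordinate preserves a product measure. -/
lemma measurePreserving_update_pi (μ : Measure ℝ) [IsProbabilityMeasure μ] (i : ι) :
    MeasurePreserving (fun p : (ι → ℝ) × ℝ => Function.update p.1 i p.2)
      ((Measure.pi fun _ : ι => μ).prod μ) (Measure.pi fun _ : ι => μ) := by
  have hm : Measurable fun p : (ι → ℝ) × ℝ => Function.update p.1 i p.2 := by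
    refine measurable_pi_lambda _ fun k => ?_
    by_cases h : k = i
    · subst h
      simpa using measurable_snd
    · simp only [Function.update_of_ne h]
      exact (measurable_pi_apply k).comp measurable_fst
  refine ⟨hm, (Measure.pi_eq fun s hs => ?_).symm⟩
  rw [Measure.map_apply hm (MeasurableSet.univ_pi hs)]
  have hpre : (fun p : (ι → ℝ) × ℝ => Function.update p.1 i p.2) ⁻¹' Set.univ.pi s
      = (Set.univ.pi (Function.update s i Set.univ)) ×ˢ s i := by
    ext ⟨x, t⟩
    simp only [Set.mem_preimage, Set.mem_univ_pi, Set.mem_prod]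
    constructor
    · intro h
      refine ⟨fun k => ?_, by simpa using h i⟩
      by_cases hk : k = i
      · subst hk; simp
      · simpa [Function.update_of_ne hk] using h k
    · rintro ⟨h, ht⟩ k
      by_cases hk : k = i
      · subst hk; simpa using ht
      · simpa [Function.update_of_ne hk] using h k
  rw [hpre, Measure.prod_prod, Measure.pi_pi, ← Finset.mul_prod_erase _ _ (Finset.mem_univ i),
    ← Finset.mul_prod_erase Finset.univ (fun k => μ (s k)) (Finset.mem_univ i)]
  simp only [Function.update_self, measure_univ, one_mul]
  rw [mul_comm]
  congr 1
  refine Finset.prod_congr rfl fun k hk => ?_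
  rw [Function.update_of_ne (Finset.ne_of_mem_erase hk)]

/-- Stein's identity for a vector of independent standard normal variables. -/
lemma integral_coord_mul_stdPi (i : ι) {f f' : (ι → ℝ) → ℝ}
    (hd : ∀ x, HasDerivAt (fun t : ℝ => f (x + t • Pi.single i 1)) (f' x) 0)
    (hf : Integrable f (stdPi ι)) (hf' : Integrable f' (stdPi ι))
    (hxf : Integrable (fun x => x i * f x) (stdPi ι)) :
    ∫ x, x i * f x ∂stdPi ι = ∫ x, f' x ∂stdPi ι := by
  have hmp := measurePreserving_update_pi (gaussianReal 0 1) i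
  have hdu : ∀ (x : ι → ℝ) (t : ℝ),
      HasDerivAt (fun τ => f (Function.update x i τ)) (f' (Function.update x i t)) t := by
    intro x t
    have h1 := hd (Function.update x i t)
    have h2 : HasDerivAt (fun τ : ℝ => τ - t) 1 t := (hasDerivAt_id t).sub_const t
    have h3 := HasDerivAt.comp_of_eq t h1 h2 (sub_self t).symm
    rw [mul_one] at h3
    refine h3.congr_of_eventuallyEq (Filter.Eventually.of_forall fun τ => ?_)
    simp only [Function.comp]
    congr 1
    ext k
    by_cases hk : k = i
    · subst hk; simp
    · simp [Function.update_of_ne hk, Pi.single_eq_of_ne hk]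
  -- Resampling coordinate `i` turns the integral over the product into an iterated one whose inner
  -- integral is one-dimensional, so the real-line identity applies to almost every slice.
  have hU : ∀ g : (ι → ℝ) → ℝ, Integrable g (stdPi ι) →
      ∫ x, g x ∂stdPi ι = ∫ x, ∫ t, g (Function.update x i t) ∂gaussianReal 0 1 ∂stdPi ι ∧
      ∀ᵐ x ∂stdPi ι, Integrable (fun t => g (Function.update x i t)) (gaussianReal 0 1) := by
    intro g hg
    have hg2 := (hmp.integrable_comp hg.aestronglyMeasurable).2 hg
    refine ⟨?_, hg2.prod_right_ae⟩
    have h5 : ∫ x, g x ∂stdPi ι = ∫ p, g (Function.update p.1 i p.2)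
        ∂((stdPi ι).prod (gaussianReal 0 1)) := by
      conv_lhs => rw [stdPi, ← hmp.map_eq]
      refine integral_map hmp.measurable.aemeasurable ?_
      rw [hmp.map_eq]
      exact hg.aestronglyMeasurable
    rw [h5]
    exact integral_prod _ hg2
  rw [(hU _ hxf).1, (hU _ hf').1]
  refine integral_congr_ae ?_
  filter_upwards [(hU _ hxf).2, (hU _ hf').2, (hU _ hf).2] with x h1 h2 h3
  simp only [Function.update_self] at h1 ⊢
  exact integral_id_mul_gaussianReal (hdu x) h3 h2 h1

end Pi

/-! ### Integrability and measurability of matrix expressions. -/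

section FiniteMoments

variable {α : Type*} [MeasurableSpace α] {μ : Measure α} {l m n : Type*} [Fintype m]

/-- All moments of `f` are finite. -/
def HasMoments (f : α → ℝ) (μ : Measure α) : Prop := ∀ p : ℝ≥0∞, p ≠ ∞ → MemLp f p μ

lemma HasMoments.integrable {f : α → ℝ} (hf : HasMoments f μ) : Integrable f μ :=
  memLp_one_iff_integrable.1 (hf 1 (by simp))

lemma HasMoments.add {f g : α → ℝ} (hf : HasMoments f μ) (hg : HasMoments g μ) :
    HasMoments (fun x => f x + g x) μ := fun p hp => (hf p hp).add (hg p hp)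

lemma HasMoments.sub {f g : α → ℝ} (hf : HasMoments f μ) (hg : HasMoments g μ) :
    HasMoments (fun x => f x - g x) μ := fun p hp => (hf p hp).sub (hg p hp)

/-- Hölder with exponents 2p, 2p. Each product doubles the exponent, so only the class with all
moments finite is closed under multiplication. -/
lemma HasMoments.mul {f g : α → ℝ} (hf : HasMoments f μ) (hg : HasMoments g μ) :
    HasMoments (fun x => f x * g x) μ := by
  intro p hp
  have h2 : 2 * p ≠ ∞ := ENNReal.mul_ne_top (by simp) hp
  have : ENNReal.HolderTriple (2 * p) (2 * p) p := ⟨by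
    rw [ENNReal.mul_inv (by simp) (by simp), ← add_mul, ENNReal.inv_two_add_inv_two, one_mul]⟩
  exact (hg _ h2).mul' (hf _ h2)

lemma hasMoments_const [IsFiniteMeasure μ] (c : ℝ) : HasMoments (fun _ : α => c) μ :=
  fun _ _ => memLp_const c

lemma HasMoments.sum {ι : Type*} {t : Finset ι} {f : ι → α → ℝ} (hf : ∀ i ∈ t, HasMoments (f i) μ) :
    HasMoments (fun x => ∑ i ∈ t, f i x) μ :=
  fun p hp => memLp_finsetSum t fun i hi => hf i hi p hp

lemma hasMoments_of_bound [IsFiniteMeasure μ] {f : α → ℝ} (hf : Measurable f) (K : ℝ)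
    (h : ∀ x, |f x| ≤ K) : HasMoments f μ :=
  fun _ _ => MemLp.of_bound hf.aestronglyMeasurable K (Filter.Eventually.of_forall h)

lemma HasMoments.matrix_mul {M : α → Matrix l m ℝ} {N : α → Matrix m n ℝ}
    (hM : ∀ i j, HasMoments (fun x => M x i j) μ) (hN : ∀ i j, HasMoments (fun x => N x i j) μ)
    (i : l) (j : n) : HasMoments (fun x => (M x * N x) i j) μ := by
  simp only [Matrix.mul_apply]
  exact .sum fun k _ => (hM i k).mul (hN k j)

lemma HasMoments.mulVec {M : α → Matrix l m ℝ} {v : α → m → ℝ}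
    (hM : ∀ i j, HasMoments (fun x => M x i j) μ) (hv : ∀ j, HasMoments (fun x => v x j) μ)
    (i : l) : HasMoments (fun x => (M x *ᵥ v x) i) μ := by
  simp only [Matrix.mulVec, dotProduct]
  exact .sum fun k _ => (hM i k).mul (hv k)

lemma HasMoments.dotProduct {u v : α → m → ℝ} (hu : ∀ j, HasMoments (fun x => u x j) μ)
    (hv : ∀ j, HasMoments (fun x => v x j) μ) : HasMoments (fun x => u x ⬝ᵥ v x) μ :=
  .sum fun k _ => (hu k).mul (hv k)

lemma hasMoments_coord {ι : Type*} [Fintype ι] (i : ι) :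
    HasMoments (fun x : ι → ℝ => x i) (stdPi ι) := by
  intro p hp
  have h1 : MemLp id p (gaussianReal 0 1) := IsGaussian.memLp_id _ p hp
  exact h1.comp_measurePreserving (measurePreserving_eval _ i)

end FiniteMoments

section MatrixMeasurable

variable {α : Type*} [MeasurableSpace α] {n : Type*} [Fintype n] [DecidableEq n]

lemma measurable_matrix_det {M : α → Matrix n n ℝ} (hM : ∀ i j, Measurable fun x => M x i j) :
    Measurable fun x => (M x).det := by
  simp only [Matrix.det_apply]
  exact Finset.measurable_fun_sum _ fun σ _ =>
    (Finset.measurable_fun_prod _ fun i _ => hM _ _).const_smul _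

lemma measurable_matrix_inv {M : α → Matrix n n ℝ} (hM : ∀ i j, Measurable fun x => M x i j)
    (i j : n) : Measurable fun x => (M x)⁻¹ i j := by
  simp only [Matrix.inv_def, Matrix.smul_apply, Matrix.adjugate_apply, smul_eq_mul,
    Ring.inverse_eq_inv']
  refine (measurable_matrix_det hM).inv.mul (measurable_matrix_det fun k l => ?_)
  by_cases h : k = j
  · subst h
    simp
  · simpa [Matrix.updateRow_ne h] using hM k l

end MatrixMeasurable

/-! ### Entrywise derivatives of matrix-valued functions. -/

section MatrixDeriv

variable {l m n : Type*} [Fintype m]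

/-- `M` has the derivative `M'` at `0`, entry by entry. -/
def MatrixDeriv (M : ℝ → Matrix l n ℝ) (M' : Matrix l n ℝ) : Prop :=
  ∀ i j, HasDerivAt (fun t => M t i j) (M' i j) 0

lemma MatrixDeriv.transpose {M : ℝ → Matrix l n ℝ} {M' : Matrix l n ℝ} (h : MatrixDeriv M M') :
    MatrixDeriv (fun t => (M t)ᵀ) M'ᵀ := fun i j => h j i

lemma matrixDeriv_const (A : Matrix l n ℝ) : MatrixDeriv (fun _ => A) 0 :=
  fun i j => hasDerivAt_const 0 (A i j)

lemma MatrixDeriv.mul {M : ℝ → Matrix l m ℝ} {N : ℝ → Matrix m n ℝ} {M' : Matrix l m ℝ}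
    {N' : Matrix m n ℝ} (hM : MatrixDeriv M M') (hN : MatrixDeriv N N') :
    MatrixDeriv (fun t => M t * N t) (M' * N 0 + M 0 * N') := by
  intro i j
  simp only [Matrix.mul_apply, Matrix.add_apply]
  rw [← Finset.sum_add_distrib]
  exact HasDerivAt.fun_sum fun k _ => (hM i k).mul (hN k j)

lemma MatrixDeriv.const_mul (A : Matrix l m ℝ) {N : ℝ → Matrix m n ℝ} {N' : Matrix m n ℝ}
    (hN : MatrixDeriv N N') : MatrixDeriv (fun t => A * N t) (A * N') := by
  simpa using (matrixDeriv_const A).mul hN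

lemma MatrixDeriv.mul_const {M : ℝ → Matrix l m ℝ} {M' : Matrix l m ℝ} (hM : MatrixDeriv M M')
    (A : Matrix m n ℝ) : MatrixDeriv (fun t => M t * A) (M' * A) := by
  simpa using hM.mul (matrixDeriv_const A)

lemma MatrixDeriv.add_const {M : ℝ → Matrix l n ℝ} {M' : Matrix l n ℝ} (hM : MatrixDeriv M M')
    (A : Matrix l n ℝ) : MatrixDeriv (fun t => M t + A) M' :=
  fun i j => (hM i j).add_const (A i j)

lemma MatrixDeriv.mulVec {M : ℝ → Matrix l m ℝ} {v : ℝ → m → ℝ} {M' : Matrix l m ℝ}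
    {v' : m → ℝ} (hM : MatrixDeriv M M') (hv : ∀ j, HasDerivAt (fun t => v t j) (v' j) 0) (i : l) :
    HasDerivAt (fun t => (M t *ᵥ v t) i) ((M' *ᵥ v 0 + M 0 *ᵥ v') i) 0 := by
  simp only [Matrix.mulVec, dotProduct, Pi.add_apply]
  rw [← Finset.sum_add_distrib]
  exact HasDerivAt.fun_sum fun k _ => (hM i k).mul (hv k)

-- An operator norm makes square matrices a complete normed algebra, in which inversion at a unit
-- has the derivative h ↦ −u⁻¹hu⁻¹.
open scoped Matrix.Norms.Operator in
lemma MatrixDeriv.inv [DecidableEq m] {M : ℝ → Matrix m m ℝ} {M' : Matrix m m ℝ}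
    (hM : MatrixDeriv M M') (h0 : IsUnit (M 0).det) :
    MatrixDeriv (fun t => (M t)⁻¹) (-((M 0)⁻¹ * M' * (M 0)⁻¹)) := by
  obtain ⟨u, hu⟩ := (Matrix.isUnit_iff_isUnit_det _).2 h0
  have h1 : HasDerivAt M M' 0 := by
    exact hasDerivAt_pi.2 fun i => hasDerivAt_pi.2 (hM i)
  have h2 := hasFDerivAt_ringInverse (𝕜 := ℝ) u
  rw [hu] at h2
  have h3 := h2.comp_hasDerivAt (0 : ℝ) h1
  have h4 : ((↑u⁻¹ : Matrix m m ℝ)) = (M 0)⁻¹ := by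
    rw [Matrix.nonsing_inv_eq_ringInverse, ← hu, Ring.inverse_unit]
  simp only [neg_apply, ContinuousLinearMap.mulLeftRight_apply, h4] at h3
  intro i j
  have h5 := (hasDerivAt_pi.1 h3) i
  have h6 := (hasDerivAt_pi.1 h5) j
  simpa only [Function.comp_def, Matrix.nonsing_inv_eq_ringInverse] using h6

end MatrixDeriv

/-! ### Centring, the scatter matrix and its regularised inverse. -/

variable {s q : ℕ}

/-- The matrix subtracting the mean from a vector of length `s`. -/
noncomputable def centering (s : ℕ) : Matrix (Fin s) (Fin s) ℝ :=
  1 - (s : ℝ)⁻¹ • Matrix.of fun _ _ => 1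

lemma centering_transpose : (centering s)ᵀ = centering s := by
  ext i j
  simp [centering, Matrix.one_apply, eq_comm]

lemma centering_mulVec_apply (x : Fin s → ℝ) (r : Fin s) :
    (centering s *ᵥ x) r = x r - (∑ k, x k) / s := by
  rw [centering, Matrix.sub_mulVec, Matrix.smul_mulVec, Matrix.one_mulVec]
  simp [Matrix.mulVec, dotProduct, div_eq_inv_mul]

lemma sum_centering_mulVec (hs : s ≠ 0) (x : Fin s → ℝ) : ∑ r, (centering s *ᵥ x) r = 0 := by
  have : (s : ℝ) ≠ 0 := by exact_mod_cast hs
  simp only [centering_mulVec_apply, Finset.sum_sub_distrib, Finset.sum_const, Finset.card_univ,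
    Fintype.card_fin, nsmul_eq_mul]
  field_simp
  ring

lemma centering_mul_self (hs : s ≠ 0) : centering s * centering s = centering s := by
  refine Matrix.ext_of_mulVec_single fun i => ?_
  rw [← Matrix.mulVec_mulVec]
  ext r
  rw [centering_mulVec_apply, sum_centering_mulVec hs]
  simp

lemma trace_centering (hs : s ≠ 0) : (centering s).trace = s - 1 := by
  have : (s : ℝ) ≠ 0 := by exact_mod_cast hs
  simp [centering, Matrix.trace, this]

lemma sum_centering_mul (hs : s ≠ 0) (G : Matrix (Fin s) (Fin q) ℝ) (j : Fin q) :
    ∑ r, (centering s * G) r j = 0 :=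
  sum_centering_mulVec hs fun k => G k j

/-- The matrix of centred sums of squares and products of the columns of `G`. -/
noncomputable def scatter (G : Matrix (Fin s) (Fin q) ℝ) : Matrix (Fin q) (Fin q) ℝ :=
  Gᵀ * centering s * G

lemma scatter_eq (hs : s ≠ 0) (G : Matrix (Fin s) (Fin q) ℝ) :
    scatter G = (centering s * G)ᵀ * (centering s * G) := by
  rw [Matrix.transpose_mul, centering_transpose, Matrix.mul_assoc, ← Matrix.mul_assoc (centering s),
    centering_mul_self hs, scatter, Matrix.mul_assoc]

lemma scatter_transpose (G : Matrix (Fin s) (Fin q) ℝ) : (scatter G)ᵀ = scatter G := by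
  simp [scatter, Matrix.transpose_mul, centering_transpose, Matrix.mul_assoc]

lemma posSemidef_scatter (hs : s ≠ 0) (G : Matrix (Fin s) (Fin q) ℝ) : (scatter G).PosSemidef := by
  rw [scatter_eq hs, ← Matrix.conjTranspose_eq_transpose_of_trivial]
  exact Matrix.posSemidef_conjTranspose_mul_self _

/-- The regularised inverse of the scatter matrix. -/
noncomputable def resolvent (δ : ℝ) (G : Matrix (Fin s) (Fin q) ℝ) : Matrix (Fin q) (Fin q) ℝ :=
  (scatter G + δ • 1)⁻¹

section Resolvent

variable {δ : ℝ} (hδ : 0 < δ) (hs : s ≠ 0) (G : Matrix (Fin s) (Fin q) ℝ)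

include hδ hs

lemma posDef_scatter_add : (scatter G + δ • 1).PosDef :=
  Matrix.PosDef.posSemidef_add (posSemidef_scatter hs G) (Matrix.PosDef.one.smul hδ)

lemma isUnit_det_scatter_add : IsUnit (scatter G + δ • 1).det :=
  (Matrix.isUnit_iff_isUnit_det _).1 (posDef_scatter_add hδ hs G).isUnit

lemma posDef_resolvent : (resolvent δ G).PosDef := (posDef_scatter_add hδ hs G).inv

lemma scatter_mul_resolvent : scatter G * resolvent δ G = 1 - δ • resolvent δ G := by
  have h := Matrix.mul_nonsing_inv _ (isUnit_det_scatter_add hδ hs G)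
  rw [add_mul, Matrix.smul_mul, one_mul] at h
  exact eq_sub_of_add_eq h

lemma scatter_mulVec_resolvent (u : Fin q → ℝ) :
    scatter G *ᵥ (resolvent δ G *ᵥ u) = u - δ • (resolvent δ G *ᵥ u) := by
  rw [Matrix.mulVec_mulVec, scatter_mul_resolvent hδ hs, Matrix.sub_mulVec, Matrix.one_mulVec,
    Matrix.smul_mulVec]

lemma resolvent_dotProduct_nonneg (u : Fin q → ℝ) : 0 ≤ (resolvent δ G *ᵥ u) ⬝ᵥ u := by
  have := (posDef_resolvent hδ hs G).posSemidef.dotProduct_mulVec_nonneg u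
  rwa [dotProduct_comm]

/-- With w = Ru one has Tw = u − δw, and w·Tw ≥ 0. -/
lemma mul_resolvent_sq_le (u : Fin q → ℝ) :
    δ * ((resolvent δ G *ᵥ u) ⬝ᵥ (resolvent δ G *ᵥ u)) ≤ (resolvent δ G *ᵥ u) ⬝ᵥ u := by
  have h := (posSemidef_scatter hs G).dotProduct_mulVec_nonneg (resolvent δ G *ᵥ u)
  rw [scatter_mulVec_resolvent hδ hs, dotProduct_sub, dotProduct_smul, star_trivial,
    smul_eq_mul] at h
  linarith

/-- Let N = |R e_j|². Then δN ≤ R_jj, and R_jj² ≤ N forces δR_jj ≤ 1, whence (δR_ij)² ≤ δ²N ≤ 1.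
Boundedness gives the regularised inverse all moments, which T⁻¹ need not have. -/
lemma abs_resolvent_apply_le (i j : Fin q) : |resolvent δ G i j| ≤ δ⁻¹ := by
  have h := mul_resolvent_sq_le hδ hs G (Pi.single j 1)
  have hle : ∀ k, (resolvent δ G k j) ^ 2 ≤ (resolvent δ G *ᵥ Pi.single j 1) ⬝ᵥ
      (resolvent δ G *ᵥ Pi.single j 1) := by
    intro k
    simp only [dotProduct, Matrix.mulVec_single_one, Matrix.col_apply, ← pow_two]
    exact Finset.single_le_sum (f := fun k => (resolvent δ G k j) ^ 2)
      (fun _ _ => sq_nonneg _) (Finset.mem_univ k)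
  set N := (resolvent δ G *ᵥ Pi.single j 1) ⬝ᵥ (resolvent δ G *ᵥ Pi.single j 1)
  simp only [dotProduct_single, Matrix.mulVec_single_one, Matrix.col_apply, mul_one] at h
  have hj : δ * resolvent δ G j j ≤ 1 := by
    by_contra! hc
    have h1 := hle j
    have h2 : 0 < resolvent δ G j j := pos_of_mul_pos_right (by linarith) hδ.le
    nlinarith
  have hN : (δ * resolvent δ G i j) ^ 2 ≤ 1 := by
    have := hle i
    calc (δ * resolvent δ G i j) ^ 2 = δ * (δ * resolvent δ G i j ^ 2) := by ring
      _ ≤ δ * (δ * N) := by gcongr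
      _ ≤ δ * resolvent δ G j j := by gcongr
      _ ≤ 1 := hj
  have h3 : |δ * resolvent δ G i j| ≤ 1 := (sq_le_one_iff_abs_le_one _).1 hN
  rw [abs_mul, abs_of_pos hδ] at h3
  rwa [← one_div, le_div_iff₀' hδ]

end Resolvent

/-! ### Stein's identity for the scatter matrix. -/

/-- The divergence of the field `G ↦ V R u uᵀ`, where `V` is the centred `G`, `R` the inverse of
`Vᵀ V + δ` and the `j`-th coordinate of `u` has derivative `κ` along each entry of column `j`. -/
lemma sum_divergence {C : Matrix (Fin s) (Fin s) ℝ} {G : Matrix (Fin s) (Fin q) ℝ}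
    {R : Matrix (Fin q) (Fin q) ℝ} {u : Fin q → ℝ} {κ : ℝ} (hC : Cᵀ = C)
    (hV : ∀ j, ∑ r, (C * G) r j = 0) :
    ∑ r, ∑ j, ((((C * Matrix.single r j (1 : ℝ) * R + (C * G) * -(R * (((Matrix.single r j (1 : ℝ))ᵀ * C) * G +
        (Gᵀ * C) * Matrix.single r j (1 : ℝ)) * R)) *ᵥ u + (C * G * R) *ᵥ (κ • Pi.single j 1)) r * u j)
        + ((C * G * R) *ᵥ u) r * κ)
      = C.trace * ((R *ᵥ u) ⬝ᵥ u) - (R *ᵥ u) ⬝ᵥ (((C * G)ᵀ * (C * G)) *ᵥ (R *ᵥ u))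
        - ((C * G)ᵀ * (C * G) * R).trace * ((R *ᵥ u) ⬝ᵥ u) := by
  obtain ⟨V, hVdef⟩ : ∃ V, V = C * G := ⟨_, rfl⟩
  rw [← hVdef] at hV ⊢
  have hVt : Gᵀ * C = Vᵀ := by rw [hVdef, Matrix.transpose_mul, hC]
  set w := R *ᵥ u with hw
  have hent : ∀ r j, (((C * Matrix.single r j (1 : ℝ) * R + V * -(R * (((Matrix.single r j (1 : ℝ))ᵀ * C) * G +
        (Gᵀ * C) * Matrix.single r j (1 : ℝ)) * R)) *ᵥ u + (V * R) *ᵥ (κ • Pi.single j 1)) r * u j)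
        + ((V * R) *ᵥ u) r * κ
      = C r r * (w j * u j) - (V * R) r j * u j * (V *ᵥ w) r - (V * R * Vᵀ) r r * (w j * u j)
        + κ * ((V * R) r j * u j) + (V *ᵥ w) r * κ := by
    intro r j
    have e1 : ((C * Matrix.single r j (1 : ℝ) * R) *ᵥ u) r = C r r * w j := by
      rw [← Matrix.mulVec_mulVec, ← Matrix.mulVec_mulVec, ← hw, Matrix.single_mulVec]
      simp [Matrix.mulVec, dotProduct, Function.update_apply]
    have e2 : ((V * (R * (((Matrix.single r j (1 : ℝ))ᵀ * C) * G) * R)) *ᵥ u) r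
        = (V * R) r j * (V *ᵥ w) r := by
      rw [Matrix.mul_assoc (Matrix.single r j (1 : ℝ))ᵀ, ← hVdef, Matrix.transpose_single,
        show V * (R * (Matrix.single j r (1 : ℝ) * V) * R) = (V * R) * (Matrix.single j r (1 : ℝ)) * V * R by
          simp only [Matrix.mul_assoc],
        ← Matrix.mulVec_mulVec, ← hw, ← Matrix.mulVec_mulVec, ← Matrix.mulVec_mulVec,
        Matrix.single_mulVec]
      simp [Matrix.mulVec, dotProduct, Function.update_apply]
    have e3 : ((V * (R * ((Gᵀ * C) * Matrix.single r j (1 : ℝ)) * R)) *ᵥ u) r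
        = (V * R * Vᵀ) r r * w j := by
      rw [hVt, show V * (R * (Vᵀ * Matrix.single r j (1 : ℝ)) * R)
        = (V * R * Vᵀ) * (Matrix.single r j (1 : ℝ)) * R by simp only [Matrix.mul_assoc],
        ← Matrix.mulVec_mulVec, ← hw, ← Matrix.mulVec_mulVec, Matrix.single_mulVec]
      simp [Matrix.mulVec, dotProduct, Function.update_apply]
    have e4 : ((V * R) *ᵥ u) r = (V *ᵥ w) r := by rw [← Matrix.mulVec_mulVec]
    have e5 : ((V * R) *ᵥ (κ • Pi.single j 1)) r = κ * (V * R) r j := by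
      rw [Matrix.mulVec_smul]
      simp
    rw [e4, Pi.add_apply, e5, Matrix.mul_neg, ← sub_eq_add_neg, Matrix.sub_mulVec, Pi.sub_apply, e1,
      Matrix.mul_add, Matrix.add_mul, Matrix.mul_add, Matrix.add_mulVec, Pi.add_apply, e2, e3]
    ring
  -- Every term containing κ reduces to this sum, so the dependence of u on the column means
  -- contributes nothing to the divergence.
  have hVw : ∑ r, (V *ᵥ w) r = 0 := by
    simp only [Matrix.mulVec, dotProduct]
    rw [Finset.sum_comm]
    refine Finset.sum_eq_zero fun j _ => ?_
    rw [← Finset.sum_mul, hV, zero_mul]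
  have hrow : ∀ r, ∑ j, (V * R) r j * u j = (V *ᵥ w) r := by
    intro r
    rw [hw, Matrix.mulVec_mulVec]
    rfl
  simp only [hent, Finset.sum_add_distrib, Finset.sum_sub_distrib, ← Finset.mul_sum,
    ← Finset.sum_mul, hrow, hVw, mul_zero, zero_mul, add_zero]
  have h1 : ∑ r, (V *ᵥ w) r * (V *ᵥ w) r = w ⬝ᵥ ((Vᵀ * V) *ᵥ w) := by
    rw [← Matrix.mulVec_mulVec, Matrix.dotProduct_mulVec w, Matrix.vecMul_transpose]
    rfl
  have h2 : ∑ r, (V * R * Vᵀ) r r = (Vᵀ * V * R).trace := by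
    rw [Matrix.mul_assoc Vᵀ, Matrix.trace_mul_comm Vᵀ]
    rfl
  rw [h1, h2]
  rfl

/-- A family indexed by pairs, arranged as a matrix. -/
def toMatrix (x : Fin s × Fin q → ℝ) : Matrix (Fin s) (Fin q) ℝ := Matrix.of fun r j => x (r, j)

lemma hasMoments_toMatrix (r : Fin s) (j : Fin q) :
    HasMoments (fun x => toMatrix x r j) (stdPi (Fin s × Fin q)) := hasMoments_coord (r, j)

lemma measurable_toMatrix (r : Fin s) (j : Fin q) :
    Measurable fun x : Fin s × Fin q → ℝ => toMatrix x r j := measurable_pi_apply (r, j)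

lemma measurable_matrix_mul {α : Type*} [MeasurableSpace α] {l m n : Type*} [Fintype m]
    {M : α → Matrix l m ℝ} {N : α → Matrix m n ℝ} (hM : ∀ i j, Measurable fun x => M x i j)
    (hN : ∀ i j, Measurable fun x => N x i j) (i : l) (j : n) :
    Measurable fun x => (M x * N x) i j := by
  simp only [Matrix.mul_apply]
  exact Finset.measurable_fun_sum _ fun k _ => (hM i k).mul (hN k j)

lemma measurable_scatter (i j : Fin q) :
    Measurable fun x : Fin s × Fin q → ℝ => scatter (toMatrix x) i j :=
  measurable_matrix_mul (M := fun x => (toMatrix x)ᵀ * centering s) (N := toMatrix)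
    (measurable_matrix_mul (M := fun x => (toMatrix x)ᵀ) (N := fun _ => centering s)
      (fun i j => measurable_toMatrix j i) fun _ _ => measurable_const) measurable_toMatrix i j

lemma hasMoments_resolvent {δ : ℝ} (hδ : 0 < δ) (hs : s ≠ 0) (i j : Fin q) :
    HasMoments (fun x => resolvent δ (toMatrix x) i j) (stdPi (Fin s × Fin q)) := by
  refine hasMoments_of_bound (measurable_matrix_inv (fun k l => ?_) i j) δ⁻¹
    fun x => abs_resolvent_apply_le hδ hs _ i j
  simp only [Matrix.add_apply]
  exact (measurable_scatter k l).add_const _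

/-- An affine function of the column means. -/
noncomputable def affineMean (c : Fin q → ℝ) (τ : ℝ) (G : Matrix (Fin s) (Fin q) ℝ) : Fin q → ℝ :=
  c + τ • cvMean G

lemma hasMoments_affineMean (c : Fin q → ℝ) (τ : ℝ) (j : Fin q) :
    HasMoments (fun x => affineMean c τ (toMatrix x) j) (stdPi (Fin s × Fin q)) := by
  have h : ∀ x : Fin s × Fin q → ℝ,
      affineMean c τ (toMatrix x) j = c j + (τ / s) * ∑ r, toMatrix x r j := by
    intro x
    simp only [affineMean, cvMean, Pi.add_apply, Pi.smul_apply, smul_eq_mul]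
    ring
  simp only [h]
  exact (hasMoments_const _).add ((hasMoments_const _).mul (.sum fun r _ => hasMoments_toMatrix r j))

lemma matrixDeriv_toMatrix (x : Fin s × Fin q → ℝ) (r : Fin s) (j : Fin q) :
    MatrixDeriv (fun t : ℝ => toMatrix (x + t • Pi.single (r, j) 1))
      (Matrix.single r j (1 : ℝ)) := by
  intro a b
  have h : (Matrix.single r j (1 : ℝ)) a b = (Pi.single (r, j) (1 : ℝ) : _ → ℝ) (a, b) := by
    simp only [Matrix.single_apply, Pi.single_apply, Prod.mk.injEq]
    congr 1
    exact propext ⟨fun h => ⟨h.1.symm, h.2.symm⟩, fun h => ⟨h.1.symm, h.2.symm⟩⟩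
  rw [h]
  simpa [toMatrix] using ((hasDerivAt_id (0 : ℝ)).mul_const _).const_add (x (a, b))

lemma hasDerivAt_affineMean (c : Fin q → ℝ) (τ : ℝ) (x : Fin s × Fin q → ℝ) (r : Fin s)
    (j k : Fin q) :
    HasDerivAt (fun t : ℝ => affineMean c τ (toMatrix (x + t • Pi.single (r, j) 1)) k)
      (((τ / s) • Pi.single j 1 : Fin q → ℝ) k) 0 := by
  have h1 := ((HasDerivAt.fun_sum (u := Finset.univ)
    fun i _ => matrixDeriv_toMatrix x r j i k).const_mul (τ / s)).const_add (c k)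
  have h2 : τ / s * ∑ i, (Matrix.single r j (1 : ℝ)) i k
      = ((τ / s) • Pi.single j 1 : Fin q → ℝ) k := by
    by_cases hk : k = j
    · subst hk
      simp [Matrix.single_apply]
    · simp [hk, Ne.symm hk]
  rw [h2] at h1
  refine h1.congr_of_eventuallyEq (Filter.Eventually.of_forall fun t => ?_)
  simp only [affineMean, cvMean, Pi.add_apply, Pi.smul_apply, smul_eq_mul]
  ring

variable {δ : ℝ}

/-- Stein's identity for the field `G ↦ V R u uᵀ`, where `V` is the centred `G`, `R` the regularised
inverse of the scatter matrix and `u` an affine function of the column means. -/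
lemma integral_stein_scatter (hδ : 0 < δ) (hs : s ≠ 0) (c : Fin q → ℝ) (τ : ℝ) :
    Integrable (fun x => affineMean c τ (toMatrix x) ⬝ᵥ affineMean c τ (toMatrix x))
      (stdPi (Fin s × Fin q)) ∧
    Integrable (fun x => ((s : ℝ) - 2 - q) *
        ((resolvent δ (toMatrix x) *ᵥ affineMean c τ (toMatrix x)) ⬝ᵥ affineMean c τ (toMatrix x))
      + δ * ((resolvent δ (toMatrix x) *ᵥ affineMean c τ (toMatrix x)) ⬝ᵥ
          (resolvent δ (toMatrix x) *ᵥ affineMean c τ (toMatrix x))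
        + ((resolvent δ (toMatrix x)).trace + 1) *
          ((resolvent δ (toMatrix x) *ᵥ affineMean c τ (toMatrix x)) ⬝ᵥ
            affineMean c τ (toMatrix x)))) (stdPi (Fin s × Fin q)) ∧
    ∫ x, (((s : ℝ) - 2 - q) *
        ((resolvent δ (toMatrix x) *ᵥ affineMean c τ (toMatrix x)) ⬝ᵥ affineMean c τ (toMatrix x))
      + δ * ((resolvent δ (toMatrix x) *ᵥ affineMean c τ (toMatrix x)) ⬝ᵥ
          (resolvent δ (toMatrix x) *ᵥ affineMean c τ (toMatrix x))
        + ((resolvent δ (toMatrix x)).trace + 1) *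
          ((resolvent δ (toMatrix x) *ᵥ affineMean c τ (toMatrix x)) ⬝ᵥ
            affineMean c τ (toMatrix x)))) ∂stdPi (Fin s × Fin q)
      = ∫ x, affineMean c τ (toMatrix x) ⬝ᵥ affineMean c τ (toMatrix x)
          ∂stdPi (Fin s × Fin q) := by
  set μ := stdPi (Fin s × Fin q)
  set C := centering s with hC
  have mG : ∀ r j, HasMoments (fun x => toMatrix x r j) μ := hasMoments_toMatrix
  have mGt : ∀ j r, HasMoments (fun x => (toMatrix x)ᵀ j r) μ := fun j r => hasMoments_toMatrix r j
  have mu : ∀ j, HasMoments (fun x => affineMean c τ (toMatrix x) j) μ := hasMoments_affineMean c τ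
  have mR : ∀ i j, HasMoments (fun x => resolvent δ (toMatrix x) i j) μ :=
    hasMoments_resolvent hδ hs
  have mc : ∀ {m n : Type} (A : Matrix m n ℝ) i j, HasMoments (fun _ => A i j) μ :=
    fun A i j => hasMoments_const _
  have mw := fun i => HasMoments.mulVec mR mu i
  have mCG := fun i j => HasMoments.matrix_mul (mc C) mG i j
  have mV := fun i => HasMoments.mulVec (fun i j => HasMoments.matrix_mul mCG mR i j) mu i
  have mwu := HasMoments.dotProduct mw mu
  have mww := HasMoments.dotProduct mw mw
  have muu := HasMoments.dotProduct mu mu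
  have mtr : HasMoments (fun x => (resolvent δ (toMatrix x)).trace) μ :=
    .sum fun i _ => mR i i
  have mF := ((hasMoments_const (μ := μ) ((s : ℝ) - 2 - q)).mul mwu).add
    ((hasMoments_const (μ := μ) δ).mul (mww.add ((mtr.add (hasMoments_const 1)).mul mwu)))
  refine ⟨muu.integrable, mF.integrable, ?_⟩
  let E : Fin s → Fin q → Matrix (Fin s) (Fin q) ℝ := fun r j => Matrix.single r j (1 : ℝ)
  let f : Fin s → Fin q → (Fin s × Fin q → ℝ) → ℝ := fun r j x =>
    ((C * toMatrix x * resolvent δ (toMatrix x)) *ᵥ affineMean c τ (toMatrix x)) r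
      * affineMean c τ (toMatrix x) j
  let M' : Fin s → Fin q → (Fin s × Fin q → ℝ) → Matrix (Fin s) (Fin q) ℝ := fun r j x =>
    C * E r j * resolvent δ (toMatrix x) + C * toMatrix x * -(resolvent δ (toMatrix x) *
      (((E r j)ᵀ * C) * toMatrix x + ((toMatrix x)ᵀ * C) * E r j) * resolvent δ (toMatrix x))
  let f' : Fin s → Fin q → (Fin s × Fin q → ℝ) → ℝ := fun r j x =>
    ((M' r j x *ᵥ affineMean c τ (toMatrix x) + (C * toMatrix x * resolvent δ (toMatrix x)) *ᵥ
        ((τ / s) • Pi.single j 1)) r * affineMean c τ (toMatrix x) j)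
      + ((C * toMatrix x * resolvent δ (toMatrix x)) *ᵥ affineMean c τ (toMatrix x)) r * (τ / s)
  have hderiv : ∀ r j x, HasDerivAt (fun t : ℝ => f r j (x + t • Pi.single (r, j) 1))
      (f' r j x) 0 := by
    intro r j x
    have hG := matrixDeriv_toMatrix x r j
    have hS := ((hG.transpose.mul_const C).mul hG).add_const (δ • 1)
    have hR := hS.inv (isUnit_det_scatter_add hδ hs _)
    have hCGR := (hG.const_mul C).mul hR
    have hu := hasDerivAt_affineMean c τ x r j
    have h := (hCGR.mulVec hu r).mul (hu j)
    simp only [zero_smul, add_zero] at h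
    refine h.congr_deriv ?_
    simp only [f', M', E, resolvent, scatter, hC, Pi.smul_apply, Pi.single_eq_same, smul_eq_mul,
      mul_one]
  have mf : ∀ r j, HasMoments (f r j) μ := fun r j => (mV r).mul (mu j)
  have mf' : ∀ r j, HasMoments (f' r j) μ := by
    intro r j
    have mCER := fun a b => HasMoments.matrix_mul (mc (C * E r j)) mR a b
    have mS : ∀ a b, HasMoments (fun x => (((E r j)ᵀ * C) * toMatrix x +
        ((toMatrix x)ᵀ * C) * E r j) a b) μ := fun a b => (HasMoments.matrix_mul (mc ((E r j)ᵀ * C)) mG a b).add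
      (HasMoments.matrix_mul (HasMoments.matrix_mul mGt (mc C)) (mc (E r j)) a b)
    have mRSR := fun a b => HasMoments.matrix_mul (HasMoments.matrix_mul mR mS) mR a b
    have mneg : ∀ a b, HasMoments (fun x => (-(resolvent δ (toMatrix x) *
        (((E r j)ᵀ * C) * toMatrix x + ((toMatrix x)ᵀ * C) * E r j) *
          resolvent δ (toMatrix x))) a b) μ := fun a b => by
      simpa only [zero_sub] using! (hasMoments_const (μ := μ) 0).sub (mRSR a b)
    have mM : ∀ a b, HasMoments (fun x => M' r j x a b) μ := fun a b =>
      (mCER a b).add (HasMoments.matrix_mul mCG mneg a b)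
    have m1 := HasMoments.mulVec mM mu r
    have m2 := HasMoments.mulVec (fun a b => HasMoments.matrix_mul mCG mR a b)
      (fun k => hasMoments_const (μ := μ) (((τ / s) • Pi.single j 1 : Fin q → ℝ) k)) r
    exact ((m1.add m2).mul (mu j)).add ((mV r).mul (hasMoments_const _))
  have hstein : ∀ r j, ∫ x, x (r, j) * f r j x ∂μ = ∫ x, f' r j x ∂μ := fun r j =>
    integral_coord_mul_stdPi (r, j) (hderiv r j) (mf r j).integrable (mf' r j).integrable
      ((hasMoments_coord (r, j)).mul (mf r j)).integrable
  have hsum : ∫ x, ∑ r, ∑ j, x (r, j) * f r j x ∂μ = ∫ x, ∑ r, ∑ j, f' r j x ∂μ := by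
    rw [integral_finsetSum _ fun r _ => integrable_finsetSum _ fun j _ =>
        ((hasMoments_coord (r, j)).mul (mf r j)).integrable,
      integral_finsetSum _ fun r _ => integrable_finsetSum _ fun j _ => (mf' r j).integrable]
    refine Finset.sum_congr rfl fun r _ => ?_
    rw [integral_finsetSum _ fun j _ => ((hasMoments_coord (r, j)).mul (mf r j)).integrable,
      integral_finsetSum _ fun j _ => (mf' r j).integrable]
    exact Finset.sum_congr rfl fun j _ => hstein r j
  -- Pairing G with the field gives uᵀTRu, and TR = 1 − δR.
  have hL : ∀ x, ∑ r, ∑ j, x (r, j) * f r j x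
      = affineMean c τ (toMatrix x) ⬝ᵥ affineMean c τ (toMatrix x)
        - δ * ((resolvent δ (toMatrix x) *ᵥ affineMean c τ (toMatrix x)) ⬝ᵥ
          affineMean c τ (toMatrix x)) := by
    intro x
    have h1 := scatter_mulVec_resolvent hδ hs (toMatrix x) (affineMean c τ (toMatrix x))
    simp only [f]
    set u := affineMean c τ (toMatrix x)
    set R := resolvent δ (toMatrix x)
    have h2 : ∑ r, ∑ j, x (r, j) * (((C * toMatrix x * R) *ᵥ u) r * u j)
        = (toMatrix x *ᵥ u) ⬝ᵥ ((C * toMatrix x * R) *ᵥ u) := by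
      refine Finset.sum_congr rfl fun r _ => ?_
      rw [show (toMatrix x *ᵥ u) r = ∑ j, x (r, j) * u j from rfl, Finset.sum_mul]
      exact Finset.sum_congr rfl fun j _ => by ring
    rw [h2, ← Matrix.vecMul_transpose, ← Matrix.dotProduct_mulVec, Matrix.mulVec_mulVec,
      ← Matrix.mul_assoc, ← Matrix.mul_assoc, ← Matrix.mulVec_mulVec,
      show (toMatrix x)ᵀ * C * toMatrix x = scatter (toMatrix x) from rfl, h1, dotProduct_sub,
      dotProduct_smul, smul_eq_mul, dotProduct_comm u (R *ᵥ u)]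
  -- Here tr C = s − 1, wᵀTw = w·u − δ|w|² and tr(TR) = q − δ tr R, so w·u has coefficient (s − 1) −
  -- 1 − q. The term δ w·u is added and subtracted to cancel the one in `hL`; this is the `+ 1` next
  -- to the trace.
  have hRt : ∀ x, ∑ r, ∑ j, f' r j x = ((s : ℝ) - 2 - q) *
        ((resolvent δ (toMatrix x) *ᵥ affineMean c τ (toMatrix x)) ⬝ᵥ affineMean c τ (toMatrix x))
      + δ * ((resolvent δ (toMatrix x) *ᵥ affineMean c τ (toMatrix x)) ⬝ᵥ
          (resolvent δ (toMatrix x) *ᵥ affineMean c τ (toMatrix x))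
        + ((resolvent δ (toMatrix x)).trace + 1) *
          ((resolvent δ (toMatrix x) *ᵥ affineMean c τ (toMatrix x)) ⬝ᵥ
            affineMean c τ (toMatrix x)))
      - δ * ((resolvent δ (toMatrix x) *ᵥ affineMean c τ (toMatrix x)) ⬝ᵥ
          affineMean c τ (toMatrix x)) := by
    intro x
    refine (sum_divergence centering_transpose (sum_centering_mul hs _)).trans ?_
    rw [← scatter_eq hs, scatter_mulVec_resolvent hδ hs, scatter_mul_resolvent hδ hs,
      trace_centering hs, Matrix.trace_sub, Matrix.trace_smul, Matrix.trace_one, Fintype.card_fin,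
      dotProduct_sub, dotProduct_smul, smul_eq_mul, smul_eq_mul]
    ring
  simp only [hL, hRt] at hsum
  have mδ := (hasMoments_const (μ := μ) δ).mul mwu
  rw [integral_sub muu.integrable mδ.integrable, integral_sub mF.integrable mδ.integrable] at hsum
  linarith

/-! ### Almost sure invertibility and the expected Hotelling statistic. -/

lemma resolvent_trace_nonneg (hδ : 0 < δ) (hs : s ≠ 0) (G : Matrix (Fin s) (Fin q) ℝ) :
    0 ≤ (resolvent δ G).trace := (posDef_resolvent hδ hs G).posSemidef.trace_nonneg

/-- Cauchy–Schwarz in each row. The squared Frobenius norm is written by columns because Stein's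
identity controls one column at a time. -/
lemma dotProduct_mulVec_self_le {m n : Type*} [Fintype m] [Fintype n] (A : Matrix m n ℝ)
    (v : n → ℝ) : (A *ᵥ v) ⬝ᵥ (A *ᵥ v) ≤ (∑ j, A.col j ⬝ᵥ A.col j) * (v ⬝ᵥ v) := by
  have h : ∑ j, A.col j ⬝ᵥ A.col j = ∑ i, ∑ j, A i j ^ 2 := by
    rw [Finset.sum_comm]
    simp only [dotProduct, Matrix.col_apply, pow_two]
  rw [h, Finset.sum_mul]
  refine Finset.sum_le_sum fun i _ => ?_
  rw [← pow_two]
  refine (Finset.sum_mul_sq_le_sq_mul_sq Finset.univ (fun j => A i j) v).trans_eq ?_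
  simp only [dotProduct, pow_two]

/-- A null vector of T is an eigenvector of R with eigenvalue 1/δ, and the Frobenius norm dominates
it. -/
lemma inv_sq_le_of_not_isUnit (hδ : 0 < δ) (hs : s ≠ 0) {G : Matrix (Fin s) (Fin q) ℝ}
    (hG : ¬ IsUnit (scatter G).det) :
    (δ ^ 2)⁻¹ ≤ ∑ j, (resolvent δ G).col j ⬝ᵥ (resolvent δ G).col j := by
  rw [isUnit_iff_ne_zero, not_not] at hG
  obtain ⟨v, hv, hTv⟩ := Matrix.exists_mulVec_eq_zero_iff.2 hG
  have hvv : 0 < v ⬝ᵥ v := by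
    simpa using Matrix.dotProduct_star_self_pos_iff.2 hv
  have hR : δ • (resolvent δ G *ᵥ v) = v := by
    have h1 : (scatter G + δ • 1) *ᵥ v = δ • v := by
      rw [Matrix.add_mulVec, hTv, zero_add, Matrix.smul_mulVec, Matrix.one_mulVec]
    rw [← Matrix.mulVec_smul, ← h1, Matrix.mulVec_mulVec, resolvent,
      Matrix.nonsing_inv_mul _ (isUnit_det_scatter_add hδ hs G), Matrix.one_mulVec]
  have h2 := dotProduct_mulVec_self_le (resolvent δ G) v
  have h3 : v ⬝ᵥ v = δ ^ 2 * ((resolvent δ G *ᵥ v) ⬝ᵥ (resolvent δ G *ᵥ v)) := by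
    conv_lhs => rw [← hR]
    simp only [smul_dotProduct, dotProduct_smul, smul_eq_mul]
    ring
  rw [inv_le_iff_one_le_mul₀ (by positivity)]
  have h4 : v ⬝ᵥ v ≤ ((∑ j, (resolvent δ G).col j ⬝ᵥ (resolvent δ G).col j) * δ ^ 2)
      * (v ⬝ᵥ v) := by
    calc v ⬝ᵥ v = δ ^ 2 * ((resolvent δ G *ᵥ v) ⬝ᵥ (resolvent δ G *ᵥ v)) := h3
      _ ≤ δ ^ 2 * ((∑ j, (resolvent δ G).col j ⬝ᵥ (resolvent δ G).col j) * (v ⬝ᵥ v)) := by gcongr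
      _ = _ := by ring
  nlinarith

lemma hasMoments_resolvent_frobenius (hδ : 0 < δ) (hs : s ≠ 0) (j : Fin q) :
    HasMoments (fun x => (resolvent δ (toMatrix x)).col j ⬝ᵥ (resolvent δ (toMatrix x)).col j)
      (stdPi (Fin s × Fin q)) :=
  HasMoments.dotProduct (fun i => hasMoments_resolvent hδ hs i j)
    (fun i => hasMoments_resolvent hδ hs i j)

/-- Stein's identity for the constant u = e_j, that is τ = 0: the right side is 1, and since s ≥ q +
2 every term on the left other than δ|R e_j|² is nonnegative. -/
lemma integral_resolvent_frobenius_le (hδ : 0 < δ) (hs : q + 2 ≤ s) (j : Fin q) :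
    δ * ∫ x, (resolvent δ (toMatrix x)).col j ⬝ᵥ (resolvent δ (toMatrix x)).col j
      ∂stdPi (Fin s × Fin q) ≤ 1 := by
  have hs0 : s ≠ 0 := by omega
  have hsq : (0 : ℝ) ≤ (s : ℝ) - 2 - q := by
    have : ((q + 2 : ℕ) : ℝ) ≤ s := by exact_mod_cast hs
    push_cast at this
    linarith
  obtain ⟨-, hF, hint⟩ := integral_stein_scatter hδ hs0 (Pi.single j 1 : Fin q → ℝ) 0
  have haff : ∀ G : Matrix (Fin s) (Fin q) ℝ, affineMean (Pi.single j 1) 0 G = Pi.single j 1 := by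
    intro G
    simp [affineMean]
  simp only [haff] at hF hint
  have h1 : ∫ _, (Pi.single j 1 : Fin q → ℝ) ⬝ᵥ Pi.single j 1 ∂stdPi (Fin s × Fin q) = 1 := by
    simp
  rw [h1] at hint
  rw [← hint, ← integral_const_mul]
  refine integral_mono ((hasMoments_resolvent_frobenius hδ hs0 j).integrable.const_mul δ) hF
    fun x => ?_
  have h2 := resolvent_dotProduct_nonneg hδ hs0 (toMatrix x) (Pi.single j 1)
  have h3 := resolvent_trace_nonneg hδ hs0 (toMatrix x)
  have h4 := mul_nonneg hsq h2
  have h5 := mul_nonneg hδ.le (mul_nonneg (add_nonneg h3 zero_le_one) h2)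
  simp only [Matrix.mulVec_single_one] at h4 h5 ⊢
  linarith

/-- The scatter matrix of `s` standard normal vectors of dimension `q` is almost surely
invertible. -/
lemma ae_isUnit_det_scatter (hs : q + 2 ≤ s) :
    ∀ᵐ x ∂stdPi (Fin s × Fin q), IsUnit (scatter (toMatrix x)).det := by
  have hs0 : s ≠ 0 := by omega
  set A : Set (Fin s × Fin q → ℝ) := {x | ¬ IsUnit (scatter (toMatrix x)).det}
  have hbound : ∀ δ : ℝ, 0 < δ → (stdPi (Fin s × Fin q)).real A ≤ q * δ := by
    intro δ hδ
    have hint : Integrable (fun x => ∑ j, (resolvent δ (toMatrix x)).col j ⬝ᵥ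
        (resolvent δ (toMatrix x)).col j) (stdPi (Fin s × Fin q)) :=
      integrable_finsetSum _ fun j _ => (hasMoments_resolvent_frobenius hδ hs0 j).integrable
    have hnonneg : 0 ≤ᵐ[stdPi (Fin s × Fin q)] fun x => ∑ j, (resolvent δ (toMatrix x)).col j ⬝ᵥ
        (resolvent δ (toMatrix x)).col j := Filter.Eventually.of_forall fun x =>
      Finset.sum_nonneg fun j _ => Finset.sum_nonneg fun i _ => mul_self_nonneg _
    -- Markov at level δ⁻² against an expectation of at most q/δ leaves a probability of at most qδ.
    have hmarkov := mul_meas_ge_le_integral_of_nonneg hnonneg hint (δ ^ 2)⁻¹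
    rw [integral_finsetSum _ fun j _ => (hasMoments_resolvent_frobenius hδ hs0 j).integrable]
      at hmarkov
    have hle : δ * ∑ j, ∫ x, (resolvent δ (toMatrix x)).col j ⬝ᵥ (resolvent δ (toMatrix x)).col j
        ∂stdPi (Fin s × Fin q) ≤ q := by
      rw [Finset.mul_sum]
      refine (Finset.sum_le_sum fun j _ => integral_resolvent_frobenius_le hδ hs j).trans_eq ?_
      simp
    have hA : (stdPi (Fin s × Fin q)).real A ≤ (stdPi (Fin s × Fin q)).real
        {x | (δ ^ 2)⁻¹ ≤ ∑ j, (resolvent δ (toMatrix x)).col j ⬝ᵥ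
          (resolvent δ (toMatrix x)).col j} :=
      measureReal_mono fun x hx => inv_sq_le_of_not_isUnit hδ hs0 hx
    rw [inv_mul_le_iff₀ (by positivity)] at hmarkov
    calc _ ≤ _ := hA
      _ ≤ _ := hmarkov
      _ = δ * (δ * ∑ j, ∫ x, (resolvent δ (toMatrix x)).col j ⬝ᵥ (resolvent δ (toMatrix x)).col j
        ∂stdPi (Fin s × Fin q)) := by ring
      _ ≤ δ * q := by gcongr
      _ = q * δ := mul_comm _ _
  have hzero : (stdPi (Fin s × Fin q)).real A ≤ 0 := by
    refine le_of_forall_pos_le_add fun ε hε => ?_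
    have hq : (0 : ℝ) < q + 1 := by positivity
    have h1 := hbound (ε / (q + 1)) (by positivity)
    have h2 : q * (ε / (q + 1)) ≤ ε := by
      rw [mul_div_assoc', div_le_iff₀ hq]
      nlinarith
    linarith
  have h0 := le_antisymm hzero measureReal_nonneg
  rw [measureReal_eq_zero_iff] at h0
  exact h0

/-- By Cramer's formula the regularised inverse is a continuous function of δ wherever the
determinant is nonzero, hence near 0. -/
lemma tendsto_resolvent {G : Matrix (Fin s) (Fin q) ℝ} (hG : IsUnit (scatter G).det) :
    Filter.Tendsto (fun δ => resolvent δ G) (nhds 0) (nhds (scatter G)⁻¹) := by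
  have hc : Continuous fun δ : ℝ => scatter G + δ • (1 : Matrix (Fin q) (Fin q) ℝ) := by fun_prop
  have h0 : scatter G + (0 : ℝ) • (1 : Matrix (Fin q) (Fin q) ℝ) = scatter G := by simp
  have hd := hc.matrix_det.tendsto 0
  have ha := hc.matrix_adjugate.tendsto 0
  rw [h0] at hd ha
  simp only [resolvent, Matrix.inv_def, Ring.inverse_eq_inv']
  exact (hd.inv₀ hG.ne_zero).smul ha

/-- Finiteness of the expected Hotelling statistic of `s` standard normal vectors of
dimension `q`. -/
lemma lintegral_hotelling_lt_top (hs : q + 3 ≤ s) :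
    ∫⁻ x, ENNReal.ofReal (((scatter (toMatrix x))⁻¹ *ᵥ cvMean (toMatrix x)) ⬝ᵥ
      cvMean (toMatrix x)) ∂stdPi (Fin s × Fin q) < ∞ := by
  have hs0 : s ≠ 0 := by omega
  have hsq : (1 : ℝ) ≤ (s : ℝ) - 2 - q := by
    have : ((q + 3 : ℕ) : ℝ) ≤ s := by exact_mod_cast hs
    push_cast at this
    linarith
  have haff : ∀ G : Matrix (Fin s) (Fin q) ℝ, affineMean 0 1 G = cvMean G := by
    intro G
    simp [affineMean]
  have hm : ∀ j, HasMoments (fun x => cvMean (toMatrix x) j) (stdPi (Fin s × Fin q)) := by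
    intro j
    simpa only [haff] using hasMoments_affineMean (s := s) (0 : Fin q → ℝ) 1 j
  set K := ∫ x, cvMean (toMatrix x) ⬝ᵥ cvMean (toMatrix x) ∂stdPi (Fin s × Fin q)
  have hmom : ∀ δ : ℝ, 0 < δ → HasMoments (fun x => (resolvent δ (toMatrix x) *ᵥ
      cvMean (toMatrix x)) ⬝ᵥ cvMean (toMatrix x)) (stdPi (Fin s × Fin q)) := fun δ hδ =>
    HasMoments.dotProduct (HasMoments.mulVec (hasMoments_resolvent hδ hs0) hm) hm
  have hbound : ∀ δ : ℝ, 0 < δ → ∫⁻ x, ENNReal.ofReal ((resolvent δ (toMatrix x) *ᵥ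
      cvMean (toMatrix x)) ⬝ᵥ cvMean (toMatrix x)) ∂stdPi (Fin s × Fin q) ≤ ENNReal.ofReal K := by
    intro δ hδ
    rw [← ofReal_integral_eq_lintegral_ofReal (hmom δ hδ).integrable
      (Filter.Eventually.of_forall fun x => resolvent_dotProduct_nonneg hδ hs0 _ _)]
    refine ENNReal.ofReal_le_ofReal ?_
    -- Now u is the mean itself. Since s ≥ q + 3, the coefficient of uᵀRu is at least 1, so the
    -- bound `K` does not depend on δ.
    obtain ⟨-, hF, hint⟩ := integral_stein_scatter hδ hs0 (0 : Fin q → ℝ) 1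
    simp only [haff] at hF hint
    refine (integral_mono (hmom δ hδ).integrable hF fun x => ?_).trans_eq hint
    have h2 := resolvent_dotProduct_nonneg hδ hs0 (toMatrix x) (cvMean (toMatrix x))
    have h3 := resolvent_trace_nonneg hδ hs0 (toMatrix x)
    have h5 := mul_nonneg hδ.le (mul_nonneg (add_nonneg h3 zero_le_one) h2)
    have h6 : 0 ≤ δ * ((resolvent δ (toMatrix x) *ᵥ cvMean (toMatrix x)) ⬝ᵥ
        (resolvent δ (toMatrix x) *ᵥ cvMean (toMatrix x))) :=
      mul_nonneg hδ.le (Finset.sum_nonneg fun i _ => mul_self_nonneg _)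
    have h7 := mul_le_mul_of_nonneg_right hsq h2
    dsimp only
    linarith
  -- Fatou along δ = 1/(n + 1).
  have hlim : ∀ᵐ x ∂stdPi (Fin s × Fin q),
      Filter.liminf (fun n : ℕ => ENNReal.ofReal ((resolvent (1 / ((n : ℝ) + 1)) (toMatrix x) *ᵥ
        cvMean (toMatrix x)) ⬝ᵥ cvMean (toMatrix x))) Filter.atTop
      = ENNReal.ofReal (((scatter (toMatrix x))⁻¹ *ᵥ cvMean (toMatrix x)) ⬝ᵥ
        cvMean (toMatrix x)) := by
    filter_upwards [ae_isUnit_det_scatter (by omega : q + 2 ≤ s)] with x hx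
    refine Filter.Tendsto.liminf_eq ?_
    have hc : Continuous fun R : Matrix (Fin q) (Fin q) ℝ => ENNReal.ofReal
        ((R *ᵥ cvMean (toMatrix x)) ⬝ᵥ cvMean (toMatrix x)) :=
      ENNReal.continuous_ofReal.comp (by fun_prop)
    exact (hc.tendsto _).comp ((tendsto_resolvent hx).comp
      tendsto_one_div_add_atTop_nhds_zero_nat)
  rw [← lintegral_congr_ae hlim]
  refine lt_of_le_of_lt (lintegral_liminf_le' fun n => ?_) ?_
  · exact (hmom _ Nat.one_div_pos_of_nat).integrable.aestronglyMeasurable.aemeasurable.ennreal_ofReal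
  · refine lt_of_le_of_lt ?_ (ENNReal.ofReal_lt_top (r := K))
    refine (Filter.liminf_le_liminf (Filter.Eventually.of_forall fun n : ℕ =>
      hbound (1 / ((n : ℝ) + 1)) Nat.one_div_pos_of_nat)).trans_eq ?_
    exact Filter.liminf_const _

/-! ### The estimators as least squares in standardised coordinates. -/

lemma SWW_eq (hs : s ≠ 0) (w : Matrix (Fin s) (Fin q) ℝ) :
    SWW w = ((s : ℝ) - 1)⁻¹ • scatter w := by
  have hs' : (s : ℝ) ≠ 0 := by exact_mod_cast hs
  rw [SWW]
  congr 1
  ext j k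
  have h1 : scatter w j k = ∑ r, w r j * (w r k - (∑ i, w i k) / s) := by
    rw [scatter, Matrix.mul_assoc, Matrix.mul_apply]
    exact Finset.sum_congr rfl fun r _ => by
      rw [Matrix.transpose_apply]
      congr 1
      exact centering_mulVec_apply (fun i => w i k) r
  rw [h1]
  simp only [mul_sub, Finset.sum_sub_distrib, ← Finset.sum_mul, Matrix.sub_apply, Matrix.mul_apply,
    Matrix.transpose_apply, Matrix.smul_apply, Matrix.vecMulVec_apply, cvMean, smul_eq_mul]
  field_simp

lemma centering_mulVec (x : Fin s → ℝ) (r : Fin s) :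
    (centering s *ᵥ x) r = x r - rewardMean x := centering_mulVec_apply x r

lemma SXW_eq (hs : s ≠ 0) (x : Fin s → ℝ) (w : Matrix (Fin s) (Fin q) ℝ) :
    SXW x w = ((s : ℝ) - 1)⁻¹ • ((centering s * w)ᵀ *ᵥ x) := by
  have hs' : (s : ℝ) ≠ 0 := by exact_mod_cast hs
  rw [SXW, Matrix.transpose_mul, centering_transpose, ← Matrix.mulVec_mulVec]
  congr 1
  ext j
  simp only [Pi.sub_apply, Pi.smul_apply, Matrix.mulVec, dotProduct, Matrix.transpose_apply,
    smul_eq_mul]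
  have h1 : ∀ r, ∑ k, centering s r k * x k = x r - rewardMean x := centering_mulVec x
  simp only [h1, mul_sub, Finset.sum_sub_distrib, ← Finset.sum_mul, cvMean]
  field_simp

/-- The coefficients of the control variate estimator as a linear function of the noise. -/
noncomputable def weight (G : Matrix (Fin s) (Fin q) ℝ) : Fin s → ℝ :=
  fun r => 1 / (s : ℝ) - ((centering s * G) *ᵥ ((scatter G)⁻¹ *ᵥ cvMean G)) r

/-- The matrix mapping the noise to the residuals. -/
noncomputable def residualMatrix (G : Matrix (Fin s) (Fin q) ℝ) : Matrix (Fin s) (Fin s) ℝ :=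
  centering s - centering s * G * (scatter G)⁻¹ * (centering s * G)ᵀ

lemma scatter_inv_transpose (G : Matrix (Fin s) (Fin q) ℝ) :
    ((scatter G)⁻¹)ᵀ = (scatter G)⁻¹ := by
  rw [Matrix.transpose_nonsing_inv, scatter_transpose]

/-- Pythagoras: the constant vector 1/s is orthogonal to v = V T⁻¹ĝ, whose entries sum to zero, and
|v|² = ĝᵀT⁻¹(VᵀV)T⁻¹ĝ. -/
lemma weight_dotProduct_self (hs : s ≠ 0) {G : Matrix (Fin s) (Fin q) ℝ}
    (hT : IsUnit (scatter G).det) :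
    weight G ⬝ᵥ weight G = 1 / s + ((scatter G)⁻¹ *ᵥ cvMean G) ⬝ᵥ cvMean G := by
  have hs' : (s : ℝ) ≠ 0 := by exact_mod_cast hs
  set v := (centering s * G) *ᵥ ((scatter G)⁻¹ *ᵥ cvMean G) with hv
  have h1 : ∑ r, v r = 0 := by
    rw [hv, ← Matrix.mulVec_mulVec]
    exact sum_centering_mulVec hs _
  have h2 : v ⬝ᵥ v = ((scatter G)⁻¹ *ᵥ cvMean G) ⬝ᵥ cvMean G := by
    rw [hv, Matrix.dotProduct_mulVec, ← Matrix.mulVec_transpose, Matrix.mulVec_mulVec,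
      ← scatter_eq hs, Matrix.mulVec_mulVec, Matrix.mul_nonsing_inv _ hT, Matrix.one_mulVec,
      dotProduct_comm]
  have h3 : weight G ⬝ᵥ weight G
      = ∑ r, ((1 / (s : ℝ)) * (1 / s) - 2 / s * v r + v r * v r) := by
    refine Finset.sum_congr rfl fun r _ => ?_
    simp only [weight, ← hv]
    ring
  rw [h3, Finset.sum_add_distrib, Finset.sum_sub_distrib, ← Finset.mul_sum Finset.univ v, h1,
    show ∑ r, v r * v r = v ⬝ᵥ v from rfl, h2]
  simp only [Finset.sum_const, Finset.card_univ, Fintype.card_fin, nsmul_eq_mul]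
  field_simp
  ring

/-- The residual matrix is an orthogonal projection, so its squared Frobenius norm is its trace, (s
− 1) − q. This is the source of the divisor in `sigmaHatSq`. -/
lemma sum_residualMatrix_sq (hs : s ≠ 0) {G : Matrix (Fin s) (Fin q) ℝ}
    (hT : IsUnit (scatter G).det) :
    ∑ r, ∑ k, residualMatrix G r k ^ 2 = (s : ℝ) - q - 1 := by
  obtain ⟨V, hV⟩ : ∃ V, V = centering s * G := ⟨_, rfl⟩
  obtain ⟨T, hTdef⟩ : ∃ T, T = scatter G := ⟨_, rfl⟩
  have hVV : Vᵀ * V = T := by rw [hTdef, hV, scatter_eq hs]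
  have hCV : centering s * V = V := by rw [hV, ← Matrix.mul_assoc, centering_mul_self hs]
  have hVC : Vᵀ * centering s = Vᵀ := by
    rw [← centering_transpose, ← Matrix.transpose_mul, hCV]
  have hTinv : T⁻¹ * T = 1 := Matrix.nonsing_inv_mul _ (hTdef ▸ hT)
  have hTt : (T⁻¹)ᵀ = T⁻¹ := by rw [hTdef, scatter_inv_transpose]
  have hQ : residualMatrix G = centering s - V * T⁻¹ * Vᵀ := by rw [hV, hTdef, residualMatrix]
  have hQt : (residualMatrix G)ᵀ = residualMatrix G := by
    rw [hQ, Matrix.transpose_sub, Matrix.transpose_mul, Matrix.transpose_mul, hTt,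
      Matrix.transpose_transpose, centering_transpose, Matrix.mul_assoc]
  have hQQ : residualMatrix G * residualMatrix G = residualMatrix G := by
    rw [hQ, Matrix.sub_mul, Matrix.mul_sub, Matrix.mul_sub, centering_mul_self hs]
    have e1 : centering s * (V * T⁻¹ * Vᵀ) = V * T⁻¹ * Vᵀ := by
      rw [← Matrix.mul_assoc, ← Matrix.mul_assoc, hCV]
    have e2 : V * T⁻¹ * Vᵀ * centering s = V * T⁻¹ * Vᵀ := by
      rw [Matrix.mul_assoc (V * T⁻¹), hVC]
    have e3 : V * T⁻¹ * Vᵀ * (V * T⁻¹ * Vᵀ) = V * T⁻¹ * Vᵀ := by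
      calc _ = V * (T⁻¹ * (Vᵀ * V)) * T⁻¹ * Vᵀ := by simp only [Matrix.mul_assoc]
        _ = _ := by rw [hVV, hTinv, Matrix.mul_one]
    rw [e1, e2, e3, sub_self, sub_zero]
  have htr : (residualMatrix G).trace = (s : ℝ) - q - 1 := by
    rw [hQ, Matrix.trace_sub, trace_centering hs, Matrix.mul_assoc, Matrix.trace_mul_comm,
      Matrix.mul_assoc, hVV, hTinv, Matrix.trace_one, Fintype.card_fin]
    ring
  have hsum : ∑ r, ∑ k, residualMatrix G r k ^ 2
      = (residualMatrix G * (residualMatrix G)ᵀ).trace := by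
    simp only [Matrix.trace, Matrix.diag_apply, Matrix.mul_apply, Matrix.transpose_apply, pow_two]
  rw [hsum, hQt, hQQ, htr]

section Model

variable {m : Fin q → ℝ} {B : Matrix (Fin q) (Fin q) ℝ} {G w : Matrix (Fin s) (Fin q) ℝ}

lemma cvMean_model (hs : s ≠ 0) (hw : ∀ r j, w r j = m j + (G * B) r j) :
    cvMean w = m + Bᵀ *ᵥ cvMean G := by
  have hs' : (s : ℝ) ≠ 0 := by exact_mod_cast hs
  ext j
  have h1 : ∑ r, (G * B) r j = ∑ k, B k j * ∑ r, G r k := by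
    simp only [Matrix.mul_apply, Finset.mul_sum]
    rw [Finset.sum_comm]
    exact Finset.sum_congr rfl fun k _ => Finset.sum_congr rfl fun r _ => mul_comm _ _
  simp only [cvMean, hw, Finset.sum_add_distrib, h1, Finset.sum_const, Finset.card_univ,
    Fintype.card_fin, nsmul_eq_mul, Pi.add_apply, Matrix.mulVec, dotProduct, Matrix.transpose_apply,
    mul_div_assoc', ← Finset.sum_div]
  field_simp

lemma centering_mul_model (hs : s ≠ 0) (hw : ∀ r j, w r j = m j + (G * B) r j) :
    centering s * w = centering s * G * B := by
  have hs' : (s : ℝ) ≠ 0 := by exact_mod_cast hs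
  rw [Matrix.mul_assoc]
  ext r j
  have h1 := centering_mulVec_apply (fun i => w i j) r
  have h2 := centering_mulVec_apply (fun i => (G * B) i j) r
  refine h1.trans (Eq.trans ?_ h2.symm)
  simp only [hw, Finset.sum_add_distrib, Finset.sum_const, Finset.card_univ, Fintype.card_fin,
    nsmul_eq_mul]
  field_simp
  ring

lemma SWW_inv_model (hs : s ≠ 0) (hs1 : (s : ℝ) - 1 ≠ 0) (hB : IsUnit B.det)
    (hT : IsUnit (scatter G).det) (hw : ∀ r j, w r j = m j + (G * B) r j) :
    (SWW w)⁻¹ = ((s : ℝ) - 1) • (B⁻¹ * (scatter G)⁻¹ * (Bᵀ)⁻¹) := by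
  have h1 : scatter w = Bᵀ * scatter G * B := by
    rw [scatter_eq hs, centering_mul_model hs hw, Matrix.transpose_mul, scatter_eq hs G]
    simp only [Matrix.mul_assoc]
  have hBt : IsUnit (Bᵀ).det := by rwa [Matrix.det_transpose]
  refine Matrix.inv_eq_right_inv ?_
  rw [SWW_eq hs, h1, Matrix.smul_mul, Matrix.mul_smul, smul_smul, inv_mul_cancel₀ hs1, one_smul]
  calc _ = Bᵀ * (scatter G * (B * B⁻¹) * (scatter G)⁻¹) * (Bᵀ)⁻¹ := by
        simp only [Matrix.mul_assoc]
    _ = 1 := by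
      rw [Matrix.mul_nonsing_inv _ hB, Matrix.mul_one, Matrix.mul_nonsing_inv _ hT, Matrix.mul_one,
        Matrix.mul_nonsing_inv _ hBt]

/-- The quadratic form in `zFactor` is invariant under the linear change B. Its factor s − 1 cancels
against 1 − 1/s = (s − 1)/s, leaving Z = 1 + s ĝᵀT⁻¹ĝ. -/
lemma zFactor_model (hs : s ≠ 0) (hs1 : (s : ℝ) - 1 ≠ 0) (hB : IsUnit B.det)
    (hT : IsUnit (scatter G).det) (hw : ∀ r j, w r j = m j + (G * B) r j) :
    zFactor m w / s = weight G ⬝ᵥ weight G := by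
  have hs' : (s : ℝ) ≠ 0 := by exact_mod_cast hs
  have hBt : IsUnit (Bᵀ).det := by rwa [Matrix.det_transpose]
  have h1 : (cvMean w - m) ⬝ᵥ ((SWW w)⁻¹ *ᵥ (cvMean w - m))
      = ((s : ℝ) - 1) * (((scatter G)⁻¹ *ᵥ cvMean G) ⬝ᵥ cvMean G) := by
    rw [cvMean_model hs hw, add_sub_cancel_left, SWW_inv_model hs hs1 hB hT hw, Matrix.smul_mulVec,
      dotProduct_smul, smul_eq_mul, Matrix.mulVec_mulVec, Matrix.mul_assoc (B⁻¹ * _),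
      Matrix.nonsing_inv_mul _ hBt, Matrix.mul_one, Matrix.dotProduct_mulVec,
      Matrix.mulVec_transpose, Matrix.vecMul_vecMul, ← Matrix.mul_assoc,
      Matrix.mul_nonsing_inv _ hB, Matrix.one_mul,
      ← Matrix.dotProduct_mulVec, dotProduct_comm]
  rw [zFactor, h1, weight_dotProduct_self hs hT]
  have h2 : 1 - 1 / (s : ℝ) ≠ 0 := by
    intro h
    apply hs1
    field_simp at h
    simpa using h
  have h3 : (s : ℝ) * (1 - 1 / s) = s - 1 := by field_simp
  rw [add_div, div_div, mul_comm (1 - 1 / (s : ℝ)), h3, mul_div_cancel_left₀ _ hs1]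

variable {e x : Fin s → ℝ} {γ : Fin q → ℝ} {μ : ℝ}

/-- In the coordinates of G the fitted coefficients are γ plus a linear function of the noise;
centring removes the intercept μ. -/
lemma mulVec_betaHat_model (hs : s ≠ 0) (hs1 : (s : ℝ) - 1 ≠ 0) (hB : IsUnit B.det)
    (hT : IsUnit (scatter G).det) (hw : ∀ r j, w r j = m j + (G * B) r j)
    (hx : ∀ r, x r = μ + (G *ᵥ γ) r + e r) :
    B *ᵥ betaHat x w = γ + (scatter G)⁻¹ *ᵥ ((centering s * G)ᵀ *ᵥ e) := by
  have hBt : IsUnit (Bᵀ).det := by rwa [Matrix.det_transpose]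
  have h1 : (centering s * G)ᵀ *ᵥ x = scatter G *ᵥ γ + (centering s * G)ᵀ *ᵥ e := by
    have hx' : x = (fun _ => μ) + G *ᵥ γ + e := funext hx
    have h2 : (centering s * G)ᵀ *ᵥ (fun _ => μ) = 0 := by
      ext j
      simp only [Matrix.mulVec, dotProduct, Matrix.transpose_apply, ← Finset.sum_mul,
        sum_centering_mul hs, zero_mul, Pi.zero_apply]
    rw [hx', Matrix.mulVec_add, Matrix.mulVec_add, h2, zero_add, Matrix.mulVec_mulVec,
      Matrix.transpose_mul, centering_transpose, scatter]
  have h2 : B * (B⁻¹ * (scatter G)⁻¹ * (Bᵀ)⁻¹) * Bᵀ = (scatter G)⁻¹ := by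
    calc _ = (B * B⁻¹) * (scatter G)⁻¹ * ((Bᵀ)⁻¹ * Bᵀ) := by simp only [Matrix.mul_assoc]
      _ = _ := by
        rw [Matrix.mul_nonsing_inv _ hB, Matrix.nonsing_inv_mul _ hBt, Matrix.one_mul,
          Matrix.mul_one]
  rw [betaHat, SXW_eq hs, SWW_inv_model hs hs1 hB hT hw, centering_mul_model hs hw,
    Matrix.transpose_mul, ← Matrix.mulVec_mulVec, h1, Matrix.smul_mulVec, Matrix.mulVec_smul,
    Matrix.mulVec_smul, Matrix.mulVec_smul, smul_smul, mul_inv_cancel₀ hs1, one_smul,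
    Matrix.mulVec_mulVec, Matrix.mulVec_mulVec, h2, Matrix.mulVec_add, Matrix.mulVec_mulVec,
    Matrix.nonsing_inv_mul _ hT, Matrix.one_mulVec]

/-- The correction equals −(Bβ̂)·ĝ. Its part γ·ĝ cancels the same term in the reward mean, so only
noise is left around μ. -/
lemma muHatC_model (hs : s ≠ 0) (hs1 : (s : ℝ) - 1 ≠ 0) (hB : IsUnit B.det)
    (hT : IsUnit (scatter G).det) (hw : ∀ r j, w r j = m j + (G * B) r j)
    (hx : ∀ r, x r = μ + (G *ᵥ γ) r + e r) :
    muHatC m x w = μ + weight G ⬝ᵥ e := by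
  have hs' : (s : ℝ) ≠ 0 := by exact_mod_cast hs
  have h1 : betaHat x w ⬝ᵥ (m - cvMean w) = -(cvMean G ⬝ᵥ γ
      + ((centering s * G) *ᵥ ((scatter G)⁻¹ *ᵥ cvMean G)) ⬝ᵥ e) := by
    rw [cvMean_model hs hw, sub_add_cancel_left, dotProduct_neg, Matrix.dotProduct_mulVec,
      Matrix.vecMul_transpose, mulVec_betaHat_model hs hs1 hB hT hw hx, add_dotProduct,
      dotProduct_comm γ]
    congr 2
    rw [dotProduct_comm, Matrix.dotProduct_mulVec, Matrix.dotProduct_mulVec,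
      Matrix.vecMul_transpose, ← Matrix.mulVec_transpose, scatter_inv_transpose]
  have h2 : rewardMean x = μ + cvMean G ⬝ᵥ γ + (∑ r, e r) / s := by
    have h3 : ∑ r, (G *ᵥ γ) r = s * (cvMean G ⬝ᵥ γ) := by
      simp only [Matrix.mulVec, dotProduct, cvMean, Finset.mul_sum]
      rw [Finset.sum_comm]
      refine Finset.sum_congr rfl fun j _ => ?_
      rw [← Finset.sum_mul]
      field_simp
    simp only [rewardMean, hx, Finset.sum_add_distrib, h3, Finset.sum_const, Finset.card_univ,
      Fintype.card_fin, nsmul_eq_mul]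
    field_simp
  have h4 : weight G ⬝ᵥ e = (∑ r, e r) / s
      - ((centering s * G) *ᵥ ((scatter G)⁻¹ *ᵥ cvMean G)) ⬝ᵥ e := by
    simp only [weight, dotProduct, sub_mul, Finset.sum_sub_distrib, ← Finset.mul_sum]
    ring
  rw [muHatC, h1, h2, h4]
  ring

lemma residual_model (hs : s ≠ 0) (hs1 : (s : ℝ) - 1 ≠ 0) (hB : IsUnit B.det)
    (hT : IsUnit (scatter G).det) (hw : ∀ r j, w r j = m j + (G * B) r j)
    (hx : ∀ r, x r = μ + (G *ᵥ γ) r + e r) (r : Fin s) :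
    xBar m x w r - muHatC m x w = (residualMatrix G *ᵥ e) r := by
  have h1 : xBar m x w r - muHatC m x w
      = (centering s *ᵥ x) r - betaHat x w ⬝ᵥ (w r - cvMean w) := by
    rw [xBar, muHatC, centering_mulVec, dotProduct_sub, dotProduct_sub, dotProduct_sub]
    ring
  have h2 : w r - cvMean w = (centering s * w) r := by
    ext j
    exact (centering_mulVec_apply (fun i => w i j) r).symm
  have h3 : betaHat x w ⬝ᵥ (centering s * w) r = ((centering s * G) *ᵥ (B *ᵥ betaHat x w)) r := by
    rw [centering_mul_model hs hw, Matrix.mulVec_mulVec, dotProduct_comm]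
    rfl
  have h4 : (centering s *ᵥ x) r = ((centering s * G) *ᵥ γ) r + (centering s *ᵥ e) r := by
    have hx' : x = (fun _ => μ) + G *ᵥ γ + e := funext hx
    have h5 : (centering s *ᵥ fun _ => μ) r = 0 := by
      have hs' : (s : ℝ) ≠ 0 := by exact_mod_cast hs
      rw [centering_mulVec_apply]
      simp [hs']
    rw [hx', Matrix.mulVec_add, Matrix.mulVec_add, Pi.add_apply, Pi.add_apply, h5, zero_add,
      Matrix.mulVec_mulVec]
  rw [h1, h2, h3, h4, mulVec_betaHat_model hs hs1 hB hT hw hx, Matrix.mulVec_add, Pi.add_apply,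
    residualMatrix, Matrix.sub_mulVec, Pi.sub_apply]
  simp only [Matrix.mulVec_mulVec, Matrix.mul_assoc]
  ring

lemma nuHat_model (hs : s ≠ 0) (hs1 : (s : ℝ) - 1 ≠ 0) (hB : IsUnit B.det)
    (hT : IsUnit (scatter G).det) (hw : ∀ r j, w r j = m j + (G * B) r j)
    (hx : ∀ r, x r = μ + (G *ᵥ γ) r + e r) :
    nuHat m x w = (weight G ⬝ᵥ weight G) / ((s : ℝ) - q - 1) *
      ∑ r, (residualMatrix G *ᵥ e) r ^ 2 := by
  rw [← zFactor_model hs hs1 hB hT hw, nuHat, sigmaHatSq]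
  simp only [residual_model hs hs1 hB hT hw hx]
  ring

end Model

/-! ### Measurability in the standardised array and second moments of the noise. -/

lemma measurable_mulVec {α : Type*} [MeasurableSpace α] {m n : Type*} [Fintype n]
    {M : α → Matrix m n ℝ} {v : α → n → ℝ} (hM : ∀ i j, Measurable fun x => M x i j)
    (hv : ∀ j, Measurable fun x => v x j) (i : m) : Measurable fun x => (M x *ᵥ v x) i := by
  simp only [Matrix.mulVec, dotProduct]
  exact Finset.measurable_fun_sum _ fun k _ => (hM i k).mul (hv k)

lemma measurable_centering_mul (r : Fin s) (j : Fin q) :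
    Measurable fun x : Fin s × Fin q → ℝ => (centering s * toMatrix x) r j :=
  measurable_matrix_mul (M := fun _ => centering s) (N := toMatrix)
    (fun _ _ => measurable_const) measurable_toMatrix r j

lemma measurable_weight (r : Fin s) :
    Measurable fun x : Fin s × Fin q → ℝ => weight (toMatrix x) r := by
  simp only [weight]
  refine measurable_const.sub (measurable_mulVec measurable_centering_mul (fun k => ?_) r)
  refine measurable_mulVec (measurable_matrix_inv measurable_scatter) (fun j => ?_) k
  simp only [cvMean]
  exact (Finset.measurable_fun_sum _ fun r _ => measurable_toMatrix r j).div_const _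

lemma measurable_residualMatrix (r k : Fin s) :
    Measurable fun x : Fin s × Fin q → ℝ => residualMatrix (toMatrix x) r k := by
  simp only [residualMatrix, Matrix.sub_apply]
  exact measurable_const.sub (measurable_matrix_mul
    (measurable_matrix_mul measurable_centering_mul (measurable_matrix_inv measurable_scatter))
    (fun j r => measurable_centering_mul r j) r k)

lemma measurable_residualMatrix_mulVec (r : Fin s) :
    Measurable fun z : (Fin s → ℝ) × (Fin s × Fin q → ℝ) =>
      (residualMatrix (toMatrix z.2) *ᵥ z.1) r := by
  refine measurable_mulVec (M := fun z : (Fin s → ℝ) × (Fin s × Fin q → ℝ) =>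
    residualMatrix (toMatrix z.2)) (v := fun z => z.1) (fun i j => ?_) (fun j => ?_) r
  · exact Measurable.comp (g := fun x : Fin s × Fin q → ℝ => residualMatrix (toMatrix x) i j)
      (measurable_residualMatrix i j) measurable_snd
  · exact (measurable_pi_apply j).comp measurable_fst

lemma measurable_weight_sq :
    Measurable fun x : Fin s × Fin q → ℝ => weight (toMatrix x) ⬝ᵥ weight (toMatrix x) :=
  Finset.measurable_fun_sum _ fun r _ => (measurable_weight r).mul (measurable_weight r)

section Noise

variable {ρ : Measure (Fin s → ℝ)} {v : ℝ}

lemma integrable_dotProduct_sq (hL : ∀ r, MemLp (fun e => e r) 2 ρ) (a : Fin s → ℝ) :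
    Integrable (fun e => (a ⬝ᵥ e) ^ 2) ρ :=
  (memLp_finsetSum Finset.univ fun r _ => (hL r).const_mul (a r)).integrable_sq

lemma integral_dotProduct_sq (hL : ∀ r, MemLp (fun e => e r) 2 ρ)
    (hv : ∀ r k, ∫ e, e r * e k ∂ρ = if r = k then v else 0) (a : Fin s → ℝ) :
    ∫ e, (a ⬝ᵥ e) ^ 2 ∂ρ = v * (a ⬝ᵥ a) := by
  have h1 : ∀ e : Fin s → ℝ, (a ⬝ᵥ e) ^ 2 = ∑ r, ∑ k, a r * a k * (e r * e k) := by
    intro e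
    rw [pow_two, dotProduct, Finset.sum_mul_sum]
    exact Finset.sum_congr rfl fun r _ => Finset.sum_congr rfl fun k _ => by ring
  have hi : ∀ r k, Integrable (fun e : Fin s → ℝ => a r * a k * (e r * e k)) ρ := fun r k =>
    ((hL r).integrable_mul (hL k)).const_mul _
  simp only [h1]
  rw [integral_finsetSum _ fun r _ => integrable_finsetSum _ fun k _ => hi r k]
  simp only [dotProduct, Finset.mul_sum]
  refine Finset.sum_congr rfl fun r _ => ?_
  rw [integral_finsetSum _ fun k _ => hi r k]
  simp only [integral_const_mul, hv, mul_ite, mul_zero, Finset.sum_ite_eq, Finset.mem_univ, if_true]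
  ring

lemma lintegral_dotProduct_sq (hL : ∀ r, MemLp (fun e => e r) 2 ρ)
    (hv : ∀ r k, ∫ e, e r * e k ∂ρ = if r = k then v else 0) (a : Fin s → ℝ) :
    ∫⁻ e, ENNReal.ofReal ((a ⬝ᵥ e) ^ 2) ∂ρ = ENNReal.ofReal (v * (a ⬝ᵥ a)) := by
  rw [← integral_dotProduct_sq hL hv a, ofReal_integral_eq_lintegral_ofReal
    (integrable_dotProduct_sq hL a) (Filter.Eventually.of_forall fun e => sq_nonneg _)]

lemma lintegral_mul_sum_mulVec_sq (hL : ∀ r, MemLp (fun e => e r) 2 ρ)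
    (hv : ∀ r k, ∫ e, e r * e k ∂ρ = if r = k then v else 0) (Q : Matrix (Fin s) (Fin s) ℝ)
    {c : ℝ} (hc : 0 ≤ c) :
    ∫⁻ e, ENNReal.ofReal (c * ∑ r, (Q *ᵥ e) r ^ 2) ∂ρ
      = ENNReal.ofReal (c * (v * ∑ r, ∑ k, Q r k ^ 2)) := by
  have hi : ∀ r, Integrable (fun e => (Q *ᵥ e) r ^ 2) ρ := fun r =>
    integrable_dotProduct_sq hL (Q r)
  have hs : ∫ e, c * ∑ r, (Q *ᵥ e) r ^ 2 ∂ρ = c * (v * ∑ r, ∑ k, Q r k ^ 2) := by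
    rw [integral_const_mul, integral_finsetSum _ fun r _ => hi r]
    congr 1
    rw [Finset.mul_sum]
    refine Finset.sum_congr rfl fun r _ => (integral_dotProduct_sq hL hv (Q r)).trans ?_
    simp only [dotProduct, pow_two]
  rw [← hs, ofReal_integral_eq_lintegral_ofReal
    ((integrable_finsetSum _ fun r _ => hi r).const_mul c)
    (Filter.Eventually.of_forall fun e => mul_nonneg hc (Finset.sum_nonneg fun r _ => sq_nonneg _))]

end Noise

/-! ### Integrating over the noise with the control variates fixed. -/

/-- Unbiasedness of the variance estimator in terms of standardised control variates `g` and an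
independent, uncorrelated, centred noise `e`. -/
lemma unbiased_of_noise {Ω : Type*} [MeasurableSpace Ω] {P : Measure Ω} [IsProbabilityMeasure P]
    (hs : q + 2 ≤ s) {e : Ω → Fin s → ℝ} {g : Ω → Fin s × Fin q → ℝ} {v μ : ℝ} {muC nu : Ω → ℝ}
    (he : AEMeasurable e P) (hg : AEMeasurable g P) (hlaw : P.map g = stdPi (Fin s × Fin q))
    (hind : IndepFun e g P) (hL : ∀ r, MemLp (fun ω => e ω r) 2 P)
    (h0 : ∀ r, ∫ ω, e ω r ∂P = 0)
    (hv : ∀ r k, ∫ ω, e ω r * e ω k ∂P = if r = k then v else 0)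
    (hmu : ∀ ω, IsUnit (scatter (toMatrix (g ω))).det →
      muC ω = μ + weight (toMatrix (g ω)) ⬝ᵥ e ω)
    (hnu : ∀ ω, IsUnit (scatter (toMatrix (g ω))).det →
      nu ω = (weight (toMatrix (g ω)) ⬝ᵥ weight (toMatrix (g ω))) / ((s : ℝ) - q - 1) *
        ∑ r, (residualMatrix (toMatrix (g ω)) *ᵥ e ω) r ^ 2) :
    (∫⁻ ω, ENNReal.ofReal (nu ω) ∂P = evariance muC P) ∧
      (q + 3 ≤ s → MemLp muC 2 P ∧ Integrable nu P ∧ ∫ ω, nu ω ∂P = variance muC P) := by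
  have hs0 : s ≠ 0 := by omega
  have hsq : (0 : ℝ) < (s : ℝ) - q - 1 := by
    have : ((q + 2 : ℕ) : ℝ) ≤ s := by exact_mod_cast hs
    push_cast at this
    linarith
  set ρ := P.map e
  have : IsProbabilityMeasure ρ := Measure.isProbabilityMeasure_map he
  have heg : AEMeasurable (fun ω => (e ω, g ω)) P := he.prodMk hg
  have hmap : P.map (fun ω => (e ω, g ω)) = ρ.prod (stdPi (Fin s × Fin q)) := by
    rw [← hlaw]
    exact (indepFun_iff_map_prod_eq_prod_map_map he hg).1 hind
  have hLρ : ∀ r, MemLp (fun e => e r) 2 ρ := fun r =>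
    (memLp_map_measure_iff (measurable_pi_apply r).aestronglyMeasurable he).2 (hL r)
  have h0ρ : ∀ r, ∫ e, e r ∂ρ = 0 := fun r =>
    (integral_map he (measurable_pi_apply r).aestronglyMeasurable).trans (h0 r)
  have hvρ : ∀ r k, ∫ e, e r * e k ∂ρ = if r = k then v else 0 := fun r k =>
    (integral_map he ((measurable_pi_apply r).mul
      (measurable_pi_apply k)).aestronglyMeasurable).trans (hv r k)
  -- The formulas `hmu` and `hnu` are available only on this event of full probability; elsewhere
  -- `⁻¹` is a default value.
  have hunit : ∀ᵐ ω ∂P, IsUnit (scatter (toMatrix (g ω))).det := by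
    have h := ae_isUnit_det_scatter (s := s) (q := q) hs
    rw [← hlaw] at h
    exact ae_of_ae_map hg h
  obtain ⟨A, hAdef⟩ : ∃ A : (Fin s → ℝ) × (Fin s × Fin q → ℝ) → ℝ,
      A = fun z => weight (toMatrix z.2) ⬝ᵥ z.1 := ⟨_, rfl⟩
  obtain ⟨N, hNdef⟩ : ∃ N : (Fin s → ℝ) × (Fin s × Fin q → ℝ) → ℝ, N = fun z =>
      (weight (toMatrix z.2) ⬝ᵥ weight (toMatrix z.2)) / ((s : ℝ) - q - 1) *
        ∑ r, (residualMatrix (toMatrix z.2) *ᵥ z.1) r ^ 2 := ⟨_, rfl⟩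
  have hA : Measurable A := by
    rw [hAdef]
    exact Finset.measurable_fun_sum _ fun r _ =>
      ((measurable_weight r).comp measurable_snd).mul ((measurable_pi_apply r).comp measurable_fst)
  have hA2 : Measurable fun z => ENNReal.ofReal (A z ^ 2) := (hA.pow_const 2).ennreal_ofReal
  have hN : Measurable N := by
    rw [hNdef]
    exact ((measurable_weight_sq.comp measurable_snd).div_const _).mul
      (Finset.measurable_fun_sum _ fun r _ => (measurable_residualMatrix_mulVec r).pow_const 2)
  have hmu' : muC =ᵐ[P] fun ω => μ + A (e ω, g ω) := hunit.mono fun ω hω => by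
    simp only [hAdef, hmu ω hω]
  have hnu' : nu =ᵐ[P] fun ω => N (e ω, g ω) := hunit.mono fun ω hω => by
    simp only [hNdef, hnu ω hω]
  have hnonneg : ∀ z, 0 ≤ N z := fun z => by
    rw [hNdef]
    exact mul_nonneg (div_nonneg (Finset.sum_nonneg fun r _ => mul_self_nonneg _) hsq.le)
      (Finset.sum_nonneg fun r _ => sq_nonneg _)
  -- The common value of both sides of the claim.
  set I := ∫⁻ x, ENNReal.ofReal (v * (weight (toMatrix x) ⬝ᵥ weight (toMatrix x)))
    ∂stdPi (Fin s × Fin q)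
  have hIA : ∫⁻ ω, ENNReal.ofReal (A (e ω, g ω) ^ 2) ∂P = I := by
    have h1 := lintegral_map' (f := fun z => ENNReal.ofReal (A z ^ 2))
      hA2.aemeasurable heg
    rw [← h1, hmap, lintegral_prod_symm' (fun z => ENNReal.ofReal (A z ^ 2)) hA2, hAdef]
    exact lintegral_congr fun x => lintegral_dotProduct_sq hLρ hvρ (weight (toMatrix x))
  have hIN : ∫⁻ ω, ENNReal.ofReal (N (e ω, g ω)) ∂P = I := by
    have h1 := lintegral_map' (f := fun z => ENNReal.ofReal (N z)) hN.ennreal_ofReal.aemeasurable heg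
    rw [← h1, hmap, lintegral_prod_symm' (fun z => ENNReal.ofReal (N z)) hN.ennreal_ofReal, hNdef]
    refine lintegral_congr_ae ?_
    filter_upwards [ae_isUnit_det_scatter (s := s) (q := q) hs] with x hx
    have hc : 0 ≤ (weight (toMatrix x) ⬝ᵥ weight (toMatrix x)) / ((s : ℝ) - q - 1) :=
      div_nonneg (Finset.sum_nonneg fun r _ => mul_self_nonneg _) hsq.le
    -- For fixed control variates the residual sum of squares averages to v(s − q − 1), which
    -- cancels the divisor.
    refine (lintegral_mul_sum_mulVec_sq hLρ hvρ (residualMatrix (toMatrix x)) hc).trans ?_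
    rw [sum_residualMatrix_sq hs0 hx]
    congr 1
    field_simp
  have hInu : ∫⁻ ω, ENNReal.ofReal (nu ω) ∂P = I := by
    rw [← hIN]
    exact lintegral_congr_ae (hnu'.mono fun ω hω => by simp only [hω])
  have hAP : AEMeasurable (fun ω => A (e ω, g ω)) P := hA.comp_aemeasurable heg
  have hmum : AEStronglyMeasurable muC P :=
    ((hAP.const_add μ).congr hmu'.symm).aestronglyMeasurable
  have hmem : MemLp muC 2 P ↔ I < ∞ := by
    have h1 : MemLp muC 2 P ↔ MemLp (fun ω => A (e ω, g ω)) 2 P := by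
      rw [memLp_congr_ae hmu']
      constructor
      · intro h
        exact (h.sub (memLp_const μ)).ae_eq (Filter.Eventually.of_forall fun ω => by simp)
      · intro h
        exact (memLp_const μ).add h
    rw [h1, memLp_two_iff_integrable_sq hAP.aestronglyMeasurable, ← hIA]
    constructor
    · intro h
      rw [← hasFiniteIntegral_iff_ofReal (Filter.Eventually.of_forall fun ω => sq_nonneg _)]
      exact h.hasFiniteIntegral
    · intro h
      exact ⟨(hAP.pow_const 2).aestronglyMeasurable,
        (hasFiniteIntegral_iff_ofReal (Filter.Eventually.of_forall fun ω => sq_nonneg _)).2 h⟩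
  -- If `I` is finite, Fubini and the centred noise identify the mean as μ. Otherwise the estimator
  -- is not square integrable and its extended variance is infinite.
  have hevar : evariance muC P = I := by
    by_cases hI : I < ∞
    · have hmemA : Integrable (fun ω => A (e ω, g ω)) P := by
        have h2 : Integrable (fun ω => muC ω - μ) P :=
          ((hmem.2 hI).integrable (by norm_num)).sub (integrable_const μ)
        refine h2.congr (hmu'.mono fun ω hω => ?_)
        simp only [hω, add_sub_cancel_left]
      have hmean : ∫ ω, A (e ω, g ω) ∂P = 0 := by
        have h3 := integral_map heg (f := A) hA.aestronglyMeasurable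
        have h4 := (integrable_map_measure (f := fun ω => (e ω, g ω)) (g := A)
          hA.aestronglyMeasurable heg).2 hmemA
        rw [hmap] at h4
        rw [← h3, hmap, integral_prod_symm _ h4]
        have h5 : ∀ x, ∫ e, A (e, x) ∂ρ = 0 := by
          intro x
          simp only [hAdef, dotProduct]
          rw [integral_finsetSum _ fun r _ => ((hLρ r).integrable (by norm_num)).const_mul _]
          simp only [integral_const_mul, h0ρ, mul_zero, Finset.sum_const_zero]
        simp only [h5, integral_zero]
      have hmuint : ∫ ω, muC ω ∂P = μ := by
        rw [integral_congr_ae hmu', integral_add (integrable_const μ) hmemA, hmean]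
        simp
      rw [evariance_eq_lintegral_ofReal, hmuint, ← hIA]
      refine lintegral_congr_ae (hmu'.mono fun ω hω => ?_)
      simp only [hω, add_sub_cancel_left]
    · rw [evariance_eq_top hmum fun h => hI (hmem.1 h)]
      exact (not_lt_top_iff.1 hI).symm
  refine ⟨hInu.trans hevar.symm, fun hs3 => ?_⟩
  have hI : I < ∞ := by
    -- The split makes a proof that v ≥ 0 unnecessary: for v ≤ 0 the truncation `ENNReal.ofReal`
    -- already gives `I = 0`.
    by_cases hv0 : v ≤ 0
    · have h6 : I = 0 := by
        refine (lintegral_congr fun x => ?_).trans lintegral_zero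
        exact ENNReal.ofReal_of_nonpos (mul_nonpos_of_nonpos_of_nonneg hv0
          (Finset.sum_nonneg fun r _ => mul_self_nonneg _))
      rw [h6]
      exact ENNReal.zero_lt_top
    · have hv0' : 0 ≤ v := (not_le.1 hv0).le
      have h7 : I = ENNReal.ofReal v * ∫⁻ x, (ENNReal.ofReal (1 / s) + ENNReal.ofReal
          (((scatter (toMatrix x))⁻¹ *ᵥ cvMean (toMatrix x)) ⬝ᵥ cvMean (toMatrix x)))
          ∂stdPi (Fin s × Fin q) := by
        rw [← lintegral_const_mul' _ _ ENNReal.ofReal_ne_top]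
        refine lintegral_congr_ae ?_
        filter_upwards [ae_isUnit_det_scatter (s := s) (q := q) hs] with x hx
        rw [ENNReal.ofReal_mul hv0', weight_dotProduct_self hs0 hx, ENNReal.ofReal_add
          (by positivity)]
        have h8 := (posSemidef_scatter hs0 (toMatrix x)).inv.dotProduct_mulVec_nonneg
          (cvMean (toMatrix x))
        rwa [star_trivial, dotProduct_comm] at h8
      rw [h7, lintegral_add_left measurable_const]
      refine ENNReal.mul_lt_top ENNReal.ofReal_lt_top (ENNReal.add_lt_top.2 ⟨?_,
        lintegral_hotelling_lt_top hs3⟩)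
      simp
  have hnunonneg : 0 ≤ᵐ[P] nu := hnu'.mono fun ω hω => by rw [hω]; exact hnonneg _
  have hnum : AEStronglyMeasurable nu P :=
    ((hN.comp_aemeasurable heg).congr hnu'.symm).aestronglyMeasurable
  refine ⟨hmem.2 hI, ⟨hnum, (hasFiniteIntegral_iff_ofReal hnunonneg).2 (hInu.trans_lt hI)⟩, ?_⟩
  rw [integral_eq_lintegral_of_nonneg_ae hnunonneg hnum, hInu, variance, hevar]

/-! ### Whitening the control variates and regressing the reward on them. -/

open scoped MatrixOrder in
lemma exists_isUnit_det_transpose_mul_self {A : Matrix (Fin q) (Fin q) ℝ} (hA : A.PosDef) :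
    ∃ B : Matrix (Fin q) (Fin q) ℝ, IsUnit B.det ∧ A = Bᵀ * B := by
  obtain ⟨B, hB⟩ := CStarAlgebra.nonneg_iff_eq_star_mul_self.mp hA.posSemidef.nonneg
  refine ⟨B, ?_, hB⟩
  have h1 : IsUnit A.det := (Matrix.isUnit_iff_isUnit_det _).1 hA.isUnit
  rw [hB, Matrix.det_mul] at h1
  exact isUnit_of_mul_isUnit_right h1

lemma hasGaussianLaw_add_const {Ω E : Type*} [MeasurableSpace Ω] {P : Measure Ω}
    [NormedAddCommGroup E] [NormedSpace ℝ E] [MeasurableSpace E] [BorelSpace E]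
    {f : Ω → E} (hf : HasGaussianLaw f P) (c : E) :
    HasGaussianLaw (fun ω => f ω + c) P where
  isGaussian_map := by
    have h1 := hf.isGaussian_map
    have h2 : P.map (fun ω => f ω + c) = (P.map f).map (fun x => x + c) :=
      (AEMeasurable.map_map_of_aemeasurable (measurable_add_const c).aemeasurable
        hf.aemeasurable).symm
    rw [h2]
    infer_instance

/-- The noise and the standardised control variates as a function of a reward and its control
variates. -/
noncomputable def standardize (m : Fin q → ℝ) (D : Matrix (Fin q) (Fin q) ℝ) (γ : Fin q → ℝ)
    (μ : ℝ) (p : ℝ × (Fin q → ℝ)) : ℝ × (Fin q → ℝ) :=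
  (p.1 - μ - γ ⬝ᵥ ((p.2 - m) ᵥ* D), (p.2 - m) ᵥ* D)

lemma continuous_standardize (m : Fin q → ℝ) (D : Matrix (Fin q) (Fin q) ℝ) (γ : Fin q → ℝ)
    (μ : ℝ) : Continuous (standardize m D γ μ) := by
  unfold standardize
  fun_prop

lemma hasGaussianLaw_standardize {Ω : Type*} [MeasurableSpace Ω] {P : Measure Ω}
    {Y : Ω → ℝ × (Fin q → ℝ)} (hY : HasGaussianLaw Y P) (m : Fin q → ℝ)
    (D : Matrix (Fin q) (Fin q) ℝ) (γ : Fin q → ℝ) (μ : ℝ) :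
    HasGaussianLaw (fun ω => standardize m D γ μ (Y ω)) P := by
  let L : (ℝ × (Fin q → ℝ)) →ₗ[ℝ] (ℝ × (Fin q → ℝ)) :=
    { toFun := fun p => (p.1 - γ ⬝ᵥ (p.2 ᵥ* D), p.2 ᵥ* D)
      map_add' := fun p p' => by
        ext1
        · simp only [Prod.fst_add, Prod.snd_add, Matrix.add_vecMul, dotProduct_add]
          ring
        · simp only [Prod.snd_add, Matrix.add_vecMul]
      map_smul' := fun c p => by
        ext1
        · simp only [Prod.smul_fst, Prod.smul_snd, Matrix.smul_vecMul, dotProduct_smul, smul_eq_mul,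
            RingHom.id_apply]
          ring
        · simp only [Prod.smul_snd, Matrix.smul_vecMul, RingHom.id_apply] }
  have h := hasGaussianLaw_add_const (hY.map_fun (LinearMap.toContinuousLinearMap L))
    (-μ + γ ⬝ᵥ (m ᵥ* D), -(m ᵥ* D))
  refine h.congr (Filter.Eventually.of_forall fun ω => ?_)
  ext1
  · simp only [standardize, L, Matrix.sub_vecMul, dotProduct_sub,
      LinearMap.coe_toContinuousLinearMap', LinearMap.coe_mk, AddHom.coe_mk, Prod.fst_add]
    ring
  · simp only [standardize, L, Matrix.sub_vecMul, LinearMap.coe_toContinuousLinearMap',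
      LinearMap.coe_mk, AddHom.coe_mk, Prod.snd_add]
    rw [← sub_eq_add_neg]

/-- A jointly normal reward and vector of control variates with positive definite covariance can be
written as affine functions of standardised control variates and uncorrelated centred noise. -/
lemma exists_standardize {Ω : Type*} [MeasurableSpace Ω] {P : Measure Ω} [IsProbabilityMeasure P]
    {X : Ω → ℝ} {W : Ω → Fin q → ℝ} {m : Fin q → ℝ} (hG : HasGaussianLaw (fun ω => (X ω, W ω)) P)
    (hm : ∀ j, ∫ ω, W ω j ∂P = m j)
    (hcov : (Matrix.of fun j k : Fin q => cov[fun ω => W ω j, fun ω => W ω k; P]).PosDef) :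
    ∃ (B : Matrix (Fin q) (Fin q) ℝ) (γ : Fin q → ℝ) (μ : ℝ), IsUnit B.det ∧
      (∫ ω, (standardize m B⁻¹ γ μ (X ω, W ω)).1 ∂P = 0) ∧
      (∀ j, ∫ ω, (standardize m B⁻¹ γ μ (X ω, W ω)).2 j ∂P = 0) ∧
      (∀ j k, ∫ ω, (standardize m B⁻¹ γ μ (X ω, W ω)).2 j *
        (standardize m B⁻¹ γ μ (X ω, W ω)).2 k ∂P = if j = k then 1 else 0) ∧
      ∀ j, ∫ ω, (standardize m B⁻¹ γ μ (X ω, W ω)).1 *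
        (standardize m B⁻¹ γ μ (X ω, W ω)).2 j ∂P = 0 := by
  obtain ⟨B, hB, hBB⟩ := exists_isUnit_det_transpose_mul_self hcov
  -- Since the covariance is BᵀB, multiplying the centred row vector by B⁻¹ on the right makes it
  -- the identity.
  obtain ⟨g, hg⟩ : ∃ g : Ω → Fin q → ℝ, g = fun ω => (W ω - m) ᵥ* B⁻¹ := ⟨_, rfl⟩
  have hXL : MemLp X 2 P := hG.fst.memLp_two
  have hWL : ∀ k, MemLp (fun ω => W ω k) 2 P := fun k => (hG.snd.eval k).memLp_two
  have hgsum : ∀ j ω, g ω j = ∑ k, (W ω k - m k) * B⁻¹ k j := by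
    intro j ω
    rw [hg]
    rfl
  have hcL : ∀ k, MemLp (fun ω => W ω k - m k) 2 P := fun k => (hWL k).sub (memLp_const _)
  have hgL : ∀ j, MemLp (fun ω => g ω j) 2 P := by
    intro j
    simp only [hgsum]
    exact memLp_finsetSum Finset.univ fun k _ => (hcL k).mul_const _
  have hg0 : ∀ j, ∫ ω, g ω j ∂P = 0 := by
    intro j
    simp only [hgsum]
    rw [integral_finsetSum _ fun k _ => ((hcL k).integrable (by norm_num)).mul_const _]
    refine Finset.sum_eq_zero fun k _ => ?_
    rw [integral_mul_const, integral_sub ((hWL k).integrable (by norm_num)) (integrable_const _), hm]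
    simp
  have hgcov : ∀ j k, cov[fun ω => g ω j, fun ω => g ω k; P] = if j = k then 1 else 0 := by
    intro j k
    simp only [hgsum]
    rw [covariance_fun_sum_fun_sum (fun a => (hcL a).mul_const _) fun b => (hcL b).mul_const _]
    have h1 : ∀ a b, cov[fun ω => (W ω a - m a) * B⁻¹ a j, fun ω => (W ω b - m b) * B⁻¹ b k; P]
        = B⁻¹ a j * (Bᵀ * B) a b * B⁻¹ b k := by
      intro a b
      rw [covariance_mul_const_left, covariance_mul_const_right,
        covariance_sub_const_left ((hWL a).integrable (by norm_num)),
        covariance_sub_const_right ((hWL b).integrable (by norm_num)), ← hBB, Matrix.of_apply]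
      ring
    simp only [h1]
    have h2 : (B⁻¹)ᵀ * (Bᵀ * B) * B⁻¹ = 1 := by
      rw [← Matrix.mul_assoc, ← Matrix.transpose_mul, Matrix.mul_nonsing_inv _ hB,
        Matrix.transpose_one, Matrix.one_mul, Matrix.mul_nonsing_inv _ hB]
    have h3 := congrFun (congrFun h2 j) k
    rw [Matrix.mul_apply, Matrix.one_apply] at h3
    rw [← h3, Finset.sum_comm]
    refine Finset.sum_congr rfl fun b _ => ?_
    rw [Matrix.mul_apply, Finset.sum_mul]
    rfl
  -- As g has identity covariance, the regression coefficients of X on g are plain covariances, and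
  -- the residual is uncorrelated with g.
  obtain ⟨γ, hγ⟩ : ∃ γ : Fin q → ℝ, γ = fun j => cov[X, fun ω => g ω j; P] := ⟨_, rfl⟩
  have hXcL : MemLp (fun ω => X ω - ∫ ω, X ω ∂P) 2 P := hXL.sub (memLp_const _)
  have hγL : MemLp (fun ω => γ ⬝ᵥ g ω) 2 P :=
    memLp_finsetSum Finset.univ fun k _ => (hgL k).const_mul _
  have heL : MemLp (fun ω => X ω - ∫ ω, X ω ∂P - γ ⬝ᵥ g ω) 2 P :=
    hXcL.sub hγL
  have hst : ∀ ω, standardize m B⁻¹ γ (∫ ω, X ω ∂P) (X ω, W ω)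
      = (X ω - ∫ ω, X ω ∂P - γ ⬝ᵥ g ω, g ω) := by
    intro ω
    rw [hg]
    rfl
  refine ⟨B, γ, ∫ ω, X ω ∂P, hB, ?_, ?_, ?_, ?_⟩
  · simp only [hst]
    have h4 : ∫ ω, γ ⬝ᵥ g ω ∂P = 0 := by
      simp only [dotProduct]
      rw [integral_finsetSum _ fun k _ => ((hgL k).integrable (by norm_num)).const_mul _]
      simp only [integral_const_mul, hg0, mul_zero, Finset.sum_const_zero]
    rw [integral_sub (hXcL.integrable (by norm_num))
      (hγL.integrable (by norm_num)), integral_sub (hXL.integrable (by norm_num))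
      (integrable_const _), h4]
    simp
  · simpa only [hst] using hg0
  · intro j k
    have h5 := covariance_eq_sub (hgL j) (hgL k)
    rw [hg0 j, zero_mul, sub_zero, hgcov] at h5
    simpa only [hst, Pi.mul_apply] using h5.symm
  · intro j
    have h6 := covariance_eq_sub heL (hgL j)
    rw [hg0 j, mul_zero, sub_zero] at h6
    have h7 : cov[fun ω => X ω - ∫ ω, X ω ∂P - γ ⬝ᵥ g ω, fun ω => g ω j; P] = 0 := by
      rw [covariance_fun_sub_left hXcL hγL (hgL j)]
      have h8 : cov[fun ω => γ ⬝ᵥ g ω, fun ω => g ω j; P] = γ j := by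
        simp only [dotProduct]
        rw [covariance_fun_sum_left (fun k => (hgL k).const_mul _) (hgL j)]
        simp only [covariance_const_mul_left, hgcov, mul_ite, mul_one, mul_zero, Finset.sum_ite_eq',
          Finset.mem_univ, if_true]
      have h9 : cov[fun ω => X ω - ∫ ω, X ω ∂P, fun ω => g ω j; P] = γ j := by
        rw [covariance_sub_const_left (hXL.integrable (by norm_num)), hγ]
      rw [h8]
      exact sub_eq_zero.2 h9
    rw [h7] at h6
    simpa only [hst, Pi.mul_apply] using h6.symm

end ControlVariates

/-! ### Reduction of the theorem to independent noise. -/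

theorem mainTheorem6 {Ω : Type*} [MeasurableSpace Ω] (P : Measure Ω) [IsProbabilityMeasure P]
    (q s : ℕ) (hs : q + 2 ≤ s)
    (X : Fin s → Ω → ℝ) (W : Fin s → Ω → (Fin q → ℝ)) (m : Fin q → ℝ)
    (h_indep : iIndepFun (fun r ω => (X r ω, W r ω)) P)
    (h_ident : ∀ r r', IdentDistrib (fun ω => (X r ω, W r ω)) (fun ω => (X r' ω, W r' ω)) P P)
    (h_normal : ∀ r, HasGaussianLaw (fun ω => (X r ω, W r ω)) P)
    (h_mean : ∀ r j, ∫ ω, W r ω j ∂P = m j)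
    (h_nondeg : ∀ r, (Matrix.of fun j k : Fin q =>
      cov[fun ω => W r ω j, fun ω => W r ω k; P]).PosDef) :
    let muC : Ω → ℝ := fun ω =>
      ControlVariates.muHatC m (fun r => X r ω) (Matrix.of fun r => W r ω)
    let nu : Ω → ℝ := fun ω =>
      ControlVariates.nuHat m (fun r => X r ω) (Matrix.of fun r => W r ω)
    (∫⁻ ω, ENNReal.ofReal (nu ω) ∂P = evariance muC P) ∧
      (q + 3 ≤ s →
        MemLp muC 2 P ∧ Integrable nu P ∧ ∫ ω, nu ω ∂P = variance muC P) := by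
  intro muC nu
  have hs0 : s ≠ 0 := by omega
  have hs1 : (s : ℝ) - 1 ≠ 0 := by
    have : ((q + 2 : ℕ) : ℝ) ≤ s := by exact_mod_cast hs
    push_cast at this
    have hq : (0 : ℝ) ≤ q := q.cast_nonneg
    intro h
    linarith
  -- The samples share one law, so the standardisation built from one of them serves all.
  let r₀ : Fin s := ⟨0, by omega⟩
  obtain ⟨B, γ, μ, hB, he0, hg0, hgg, heg⟩ :=
    ControlVariates.exists_standardize (h_normal r₀) (h_mean r₀) (h_nondeg r₀)
  obtain ⟨φ, hφ⟩ : ∃ φ, φ = ControlVariates.standardize m B⁻¹ γ μ := ⟨_, rfl⟩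
  rw [← hφ] at he0 hg0 hgg heg
  have hφc : Continuous φ := hφ ▸ ControlVariates.continuous_standardize m B⁻¹ γ μ
  obtain ⟨Y, hY⟩ : ∃ Y : Fin s → Ω → ℝ × (Fin q → ℝ), Y = fun r ω => φ (X r ω, W r ω) := ⟨_, rfl⟩
  have hYG : ∀ r, HasGaussianLaw (Y r) P := by
    intro r
    rw [hY, hφ]
    exact ControlVariates.hasGaussianLaw_standardize (h_normal r) m B⁻¹ γ μ
  have hYind : iIndepFun Y P := by
    rw [hY]
    exact h_indep.comp (fun _ => φ) fun _ => hφc.measurable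
  have hYid : ∀ (r : Fin s) (F : ℝ × (Fin q → ℝ) → ℝ), Measurable F →
      ∫ ω, F (Y r ω) ∂P = ∫ ω, F (Y r₀ ω) ∂P := by
    intro r F hF
    rw [hY]
    exact ((h_ident r r₀).comp (hF.comp hφc.measurable)).integral_eq
  have hm1 : Measurable fun p : ℝ × (Fin q → ℝ) => p.1 := measurable_fst
  have hm2 : ∀ j, Measurable fun p : ℝ × (Fin q → ℝ) => p.2 j := fun j =>
    (measurable_pi_apply j).comp measurable_snd
  have ye0 : ∀ r, ∫ ω, (Y r ω).1 ∂P = 0 := fun r => by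
    rw [hYid r (fun p => p.1) hm1, hY]
    exact he0
  have yg0 : ∀ r j, ∫ ω, (Y r ω).2 j ∂P = 0 := fun r j => by
    rw [hYid r (fun p => p.2 j) (hm2 j), hY]
    exact hg0 j
  have ygg : ∀ r j k, ∫ ω, (Y r ω).2 j * (Y r ω).2 k ∂P = if j = k then 1 else 0 := fun r j k => by
    rw [hYid r (fun p => p.2 j * p.2 k) ((hm2 j).mul (hm2 k)), hY]
    exact hgg j k
  have yeg : ∀ r j, ∫ ω, (Y r ω).1 * (Y r ω).2 j ∂P = 0 := fun r j => by
    rw [hYid r (fun p => p.1 * p.2 j) (hm1.mul (hm2 j)), hY]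
    exact heg j
  have yeL : ∀ r, MemLp (fun ω => (Y r ω).1) 2 P := fun r =>
    ((hYG r).map_fun (ContinuousLinearMap.fst ℝ ℝ (Fin q → ℝ))).memLp_two
  have ygL : ∀ r j, MemLp (fun ω => (Y r ω).2 j) 2 P := fun r j =>
    (((hYG r).map_fun (ContinuousLinearMap.snd ℝ ℝ (Fin q → ℝ))).eval j).memLp_two
  obtain ⟨e, he⟩ : ∃ e : Ω → Fin s → ℝ, e = fun ω r => (Y r ω).1 := ⟨_, rfl⟩
  obtain ⟨g, hg⟩ : ∃ g : Ω → Fin s × Fin q → ℝ, g = fun ω p => (Y p.1 ω).2 p.2 := ⟨_, rfl⟩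
  -- Independent normal vectors are jointly normal. This turns the vanishing covariances below into
  -- independence.
  have hjoint : HasGaussianLaw (fun ω => (fun r => (Y r ω).1,
      fun p : Fin s × Fin q => (Y p.1 ω).2 p.2)) P := by
    let L : (Fin s → ℝ × (Fin q → ℝ)) →ₗ[ℝ] ((Fin s → ℝ) × (Fin s × Fin q → ℝ)) :=
      { toFun := fun y => (fun r => (y r).1, fun p => (y p.1).2 p.2)
        map_add' := fun _ _ => rfl
        map_smul' := fun _ _ => rfl }
    exact (hYind.hasGaussianLaw hYG).map_fun (LinearMap.toContinuousLinearMap L)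
  -- Within a sample this is the regression property; across samples it is independence.
  have hcov_eg : ∀ (r : Fin s) (p : Fin s × Fin q),
      cov[fun ω => (Y r ω).1, fun ω => (Y p.1 ω).2 p.2; P] = 0 := by
    intro r p
    by_cases hr : r = p.1
    · rw [covariance_eq_sub (yeL r) (ygL _ _), yg0, mul_zero, sub_zero, hr]
      exact yeg _ _
    · exact ((hYind.indepFun hr).comp hm1 (hm2 p.2)).covariance_eq_zero (yeL r) (ygL _ _)
  have hcov_gg : ∀ p p' : Fin s × Fin q,
      cov[fun ω => (Y p.1 ω).2 p.2, fun ω => (Y p'.1 ω).2 p'.2; P] = if p = p' then 1 else 0 := by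
    intro p p'
    by_cases hr : p.1 = p'.1
    · rw [covariance_eq_sub (ygL _ _) (ygL _ _), yg0, zero_mul, sub_zero, hr]
      refine (ygg _ _ _).trans ?_
      simp [Prod.ext_iff, hr]
    · rw [if_neg fun h => hr (congrArg Prod.fst h)]
      exact ((hYind.indepFun hr).comp (hm2 p.2) (hm2 p'.2)).covariance_eq_zero (ygL _ _) (ygL _ _)
  have hind : IndepFun e g P := by
    rw [he, hg]
    exact hjoint.indepFun_of_covariance_eval hcov_eg
  have hgm : ∀ p : Fin s × Fin q, AEMeasurable (fun ω => (Y p.1 ω).2 p.2) P := fun p =>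
    (ygL p.1 p.2).aestronglyMeasurable.aemeasurable
  have hlaw : P.map g = ControlVariates.stdPi (Fin s × Fin q) := by
    have h1 : iIndepFun (fun (p : Fin s × Fin q) ω => (Y p.1 ω).2 p.2) P :=
      hjoint.snd.iIndepFun_of_covariance_eq_zero fun p p' hp => by rw [hcov_gg, if_neg hp]
    rw [hg, (iIndepFun_iff_map_fun_eq_pi_map hgm).1 h1]
    congr 1
    funext p
    have h2 : HasGaussianLaw (fun ω => (Y p.1 ω).2 p.2) P := hjoint.snd.eval p
    rw [h2.map_eq_gaussianReal, yg0, ← covariance_self (hgm p), hcov_gg, if_pos rfl,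
      Real.toNNReal_one]
  refine ControlVariates.unbiased_of_noise (v := ∫ ω, (Y r₀ ω).1 * (Y r₀ ω).1 ∂P) (μ := μ) hs
    (he ▸ hjoint.fst.aemeasurable) (hg ▸ hjoint.snd.aemeasurable) hlaw hind (he ▸ yeL) (he ▸ ye0)
    ?_ ?_ ?_
  · intro r k
    rw [he]
    by_cases hrk : r = k
    · rw [if_pos hrk, hrk]
      exact hYid k (fun p => p.1 * p.1) (hm1.mul hm1)
    · rw [if_neg hrk]
      have h3 := ((hYind.indepFun hrk).comp hm1 hm1).covariance_eq_zero (yeL r) (yeL k)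
      have h4 := covariance_eq_sub (yeL r) (yeL k)
      rw [ye0 r, zero_mul, sub_zero] at h4
      exact h4.symm.trans h3
  -- Both remaining goals need the standardisation inverted: X = μ + Gγ + e and W = m + GB, row by
  -- row.
  all_goals
    have hx : ∀ ω r, X r ω = μ + (ControlVariates.toMatrix (g ω) *ᵥ γ) r + e ω r := by
      intro ω r
      have h5 : (ControlVariates.toMatrix (g ω) *ᵥ γ) r = γ ⬝ᵥ (Y r ω).2 := by
        rw [dotProduct_comm, hg]
        rfl
      rw [h5, he, hY, hφ]
      simp only [ControlVariates.standardize]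
      ring
    have hw : ∀ ω r j, Matrix.of (fun r => W r ω) r j
        = m j + (ControlVariates.toMatrix (g ω) * B) r j := by
      intro ω r j
      have h6 : (ControlVariates.toMatrix (g ω) * B) r j = ((Y r ω).2 ᵥ* B) j := by
        rw [hg]
        rfl
      rw [h6, hY, hφ]
      simp only [ControlVariates.standardize, Matrix.vecMul_vecMul, Matrix.nonsing_inv_mul _ hB,
        Matrix.vecMul_one, Pi.sub_apply, Matrix.of_apply]
      ring
    intro ω hT
  · exact ControlVariates.muHatC_model hs0 hs1 hB hT (hw ω) (hx ω)
  · exact ControlVariates.nuHat_model hs0 hs1 hB hT (hw ω) (hx ω)
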